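/- Let $\mathcal A,\mathcal W$ be measurable spaces, let $\rho$ be a probability measure (the law of $(\mathbf a,\mathbf y,\mathbf w)$) on $\mathcal A\times\mathbb R\times\mathcal W$, and let $(\mathbf a,x)\mapsto\Psi_{\mathbf a}(x)$ on $\mathcal A\times\mathbb R^{d_x}$ and $(\mathbf w,z)\mapsto\Psi_{\mathbf w}(z)$ on $\mathcal W\times\mathbb R^{d_z}$ be real-valued functions, measurable in the first and differentiable in the second variable. Assume that $|\mathbf y|\le M$ $\rho$-almost surely and that $|\Psi_{\mathbf a}|,|\Psi_{\mathbf w}|,\|\nabla_x\Psi_{\mathbf a}\|,\|\nabla_z\Psi_{\mathbf w}\|\le R$ everywhere, for some constants $M,R$. Let $\zeta_1,\zeta_2>0$. Let $\mathcal P_2(\mathbb R^d)$ be the set of Borel probability measures on $\mathbb R^d$ with finite second moment, with the topology of weak convergence, and let $\mathrm{Ent}(\mu)=\int\mu(x)\log\mu(x)\,\mathrm dx\in(-\infty,+\infty]$ for $\mu\in\mathcal P_2(\mathbb R^d)$ with Lebesgue density $\mu(x)$, and $\mathrm{Ent}(\mu)=+\infty$ if $\mu$ has no density. Put $$U_1(\mu_x,\mu_z)=\tfrac12\mathbb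 E_\rho\Big[\Big(\int\Psi_{\mathbf w}\,\mathrm d\mu_z-\int\Psi_{\mathbf a}\,\mathrm d\mu_x\Big)^2\Big],\qquad U_2(\mu_z)=\tfrac12\mathbb E_\rho\Big[\Big(\int\Psi_{\mathbf w}\,\mathrm d\mu_z-\mathbf y\Big)^2\Big].$$ For $\sigma_1\ge0$ and $\mu_x\in\mathcal P_2(\mathbb R^{d_x})$ consider the Stage I problem of minimizing $$\mu_z\mapsto U_1(\mu_x,\mu_z)+\tfrac{\zeta_1}2\mathbb E_{\mu_z}[\|z\|^2]+\sigma_1\mathrm{Ent}(\mu_z)$$ over $\mathcal P_2(\mathbb R^{d_z})$, where the entropy term is omitted if $\sigma_1=0$. This problem has a solution, and any two solutions have the same value of $U_2$. Let $\mu^*_{z,\sigma_1}(\mu_x)$ be a solution, chosen arbitrarily for each $\sigma_1\ge 0$ and $\mu_x$, and for $\sigma_1,\sigma_2\ge0$ let $$\mathscr F_{2,(\sigma_1,\sigma_2)}(\mu_x)=U_2(\mu^*_{z,\sigma_1}(\mu_x))+\tfrac{\zeta_2}2\mathbb E_{\mu_x}[\|x\|^2]+\sigma_2\mathrm{Ent}(\mu_x),\qquad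 \mu_x\in\mathcal P_2(\mathbb R^{d_x}),$$ where again the entropy term is omitted if $\sigma_2=0$. Then for every sequence $(\sigma_{1,n},\sigma_{2,n})\to(0,0)$ with $\sigma_{1,n},\sigma_{2,n}>0$: 1. $\mathscr F_{2,(\sigma_{1,n},\sigma_{2,n})}$ $\Gamma$-converges to $\mathscr F_{2,(0,0)}$ on $\mathcal P_2(\mathbb R^{d_x})$ with respect to the weak topology. That is, $\liminf_{n}\mathscr F_{2,(\sigma_{1,n},\sigma_{2,n})}(\mu_n)\ge\mathscr F_{2,(0,0)}(\mu)$ whenever $\mu_n\to\mu$ weakly in $\mathcal P_2(\mathbb R^{d_x})$, and for every $\mu\in\mathcal P_2(\mathbb R^{d_x})$ there are $\mu_n\in\mathcal P_2(\mathbb R^{d_x})$ with $\mu_n\to\mu$ weakly and $\limsup_{n}\mathscr F_{2,(\sigma_{1,n},\sigma_{2,n})}(\mu_n)\le\mathscr F_{2,(0,0)}(\mu)$. 2. If $\mu_n$ is a global minimizer of $\mathscr F_{2,(\sigma_{1,n},\sigma_{2,n})}$ over $\mathcal P_2(\mathbb R^{d_x})$ for every $n$ and $\mu_n$ converges weakly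 to a probability measure $\mu^\diamond$ on $\mathbb R^{d_x}$, then $\mu^\diamond\in\mathcal P_2(\mathbb R^{d_x})$ and $\mu^\diamond$ is a global minimizer of $\mathscr F_{2,(0,0)}$ over $\mathcal P_2(\mathbb R^{d_x})$. -/

import Mathlib

open MeasureTheory Filter Topology

noncomputable section

namespace DFIV

/-- The parameter space `ℝ^d` with its Euclidean norm. -/
abbrev Eucl (d : ℕ) : Type := EuclideanSpace ℝ (Fin d)

/-- `𝒫₂(ℝ^d)`: the Borel probability measures on `ℝ^d` with finite second moment. As a subtype of
`ProbabilityMeasure` it carries the topology of weak convergence. -/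
abbrev P2 (d : ℕ) : Type :=
  {μ : ProbabilityMeasure (Eucl d) //
    Integrable (fun x : Eucl d => ‖x‖ ^ 2) (μ : Measure (Eucl d))}

/-- The Borel measure underlying an element of `𝒫₂(ℝ^d)`. -/
def P2.toMeasure {d : ℕ} (μ : P2 d) : Measure (Eucl d) := (μ.1 : Measure (Eucl d))

/-- Second moment `𝔼_μ[‖x‖²]`. -/
def secondMoment {d : ℕ} (μ : P2 d) : ℝ := ∫ x, ‖x‖ ^ 2 ∂μ.toMeasure

/-- The Lebesgue density of (the absolutely continuous part of) `μ`. -/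
def density {d : ℕ} (μ : P2 d) (x : Eucl d) : ℝ := (μ.toMeasure.rnDeriv volume x).toReal

open Classical in
/-- Negative entropy `Ent(μ) = ∫ μ(x) log μ(x) dx`, equal to `+∞` when `μ` has no Lebesgue density.
For `μ` with a density and finite second moment the negative part of `μ log μ` is integrable, so
that non-integrability of `μ log μ` means that the integral is `+∞`. -/
def Ent {d : ℕ} (μ : P2 d) : EReal :=
  if μ.toMeasure ≪ (volume : Measure (Eucl d)) ∧
      Integrable (fun x => density μ x * Real.log (density μ x)) (volume : Measure (Eucl d)) then
    ((∫ x, density μ x * Real.log (density μ x) : ℝ) : EReal)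
  else ⊤

/-- The mean field network `∫ Ψ_u(θ) dμ(θ)` evaluated at the input `u`. -/
def net {U : Type*} {d : ℕ} (Ψ : U → Eucl d → ℝ) (μ : P2 d) (u : U) : ℝ :=
  ∫ θ, Ψ u θ ∂μ.toMeasure

/-- `Ψ` is measurable in the input, differentiable in the parameter, and `|Ψ|`, `|∇Ψ|` are bounded
by `R`. -/
structure BoundedSmooth {U : Type*} [MeasurableSpace U] {d : ℕ}
    (Ψ : U → Eucl d → ℝ) (R : ℝ) : Prop where
  measurable_input : ∀ θ, Measurable fun u => Ψ u θ
  differentiable : ∀ u, Differentiable ℝ (Ψ u)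
  abs_le : ∀ u θ, |Ψ u θ| ≤ R
  gradient_le : ∀ u θ, ‖gradient (Ψ u) θ‖ ≤ R

section Objectives

variable {A W : Type*} [MeasurableSpace A] [MeasurableSpace W] {dx dz : ℕ}

/-- `U₁(μ_x, μ_z) = ½ 𝔼_ρ[(∫ Ψ_w dμ_z - ∫ Ψ_a dμ_x)²]`, with `ρ` the law of `(a, y, w)`. -/
def U₁ (ρ : Measure (A × ℝ × W)) (ΨA : A → Eucl dx → ℝ) (ΨW : W → Eucl dz → ℝ)
    (μx : P2 dx) (μz : P2 dz) : ℝ :=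
  (1 / 2) * ∫ t, (net ΨW μz t.2.2 - net ΨA μx t.1) ^ 2 ∂ρ

/-- `U₂(μ_z) = ½ 𝔼_ρ[(∫ Ψ_w dμ_z - y)²]`. -/
def U₂ (ρ : Measure (A × ℝ × W)) (ΨW : W → Eucl dz → ℝ) (μz : P2 dz) : ℝ :=
  (1 / 2) * ∫ t, (net ΨW μz t.2.2 - t.2.1) ^ 2 ∂ρ

/-- Stage I objective `U₁(μ_x, μ_z) + (ζ₁/2) 𝔼_{μ_z}[‖z‖²] + σ₁ Ent(μ_z)`. For `σ₁ = 0` the entropy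
term is absent, since `0 * ⊤ = 0` in `EReal`. -/
def stageI (ρ : Measure (A × ℝ × W)) (ΨA : A → Eucl dx → ℝ) (ΨW : W → Eucl dz → ℝ)
    (ζ₁ σ₁ : ℝ) (μx : P2 dx) (μz : P2 dz) : EReal :=
  ((U₁ ρ ΨA ΨW μx μz + ζ₁ / 2 * secondMoment μz : ℝ) : EReal) + (σ₁ : EReal) * Ent μz

/-- `μz` is a global minimizer over `𝒫₂(ℝ^{d_z})` of the Stage I objective at `μx`. -/
def IsStageISolution (ρ : Measure (A × ℝ × W)) (ΨA : A → Eucl dx → ℝ) (ΨW : W → Eucl dz → ℝ)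
    (ζ₁ σ₁ : ℝ) (μx : P2 dx) (μz : P2 dz) : Prop :=
  ∀ ν : P2 dz, stageI ρ ΨA ΨW ζ₁ σ₁ μx μz ≤ stageI ρ ΨA ΨW ζ₁ σ₁ μx ν

/-- Stage II objective `U₂(μ_z) + (ζ₂/2) 𝔼_{μ_x}[‖x‖²] + σ₂ Ent(μ_x)`. -/
def stageII (ρ : Measure (A × ℝ × W)) (ΨW : W → Eucl dz → ℝ) (ζ₂ σ₂ : ℝ)
    (μx : P2 dx) (μz : P2 dz) : EReal :=
  ((U₂ ρ ΨW μz + ζ₂ / 2 * secondMoment μx : ℝ) : EReal) + (σ₂ : EReal) * Ent μx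

/-- The nested Stage II objective `μ_x ↦ ℱ_{2,(σ₁,σ₂)}(μ_x, μ*_{z,σ₁}(μ_x))`, where `zstar σ₁ μ_x`
stands for the Stage I solution `μ*_{z,σ₁}(μ_x)`. -/
def nestedII (ρ : Measure (A × ℝ × W)) (ΨW : W → Eucl dz → ℝ) (ζ₂ : ℝ)
    (zstar : ℝ → P2 dx → P2 dz) (σ : ℝ × ℝ) (μx : P2 dx) : EReal :=
  stageII ρ ΨW ζ₂ σ.2 μx (zstar σ.1 μx)

end Objectives

/-- Sequential Γ-convergence of `F n` to `G`: the liminf inequality along every convergent sequence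
and the existence of recovery sequences. -/
structure GammaConverges {X : Type*} [TopologicalSpace X] (F : ℕ → X → EReal) (G : X → EReal) :
    Prop where
  le_liminf : ∀ (x : X) (u : ℕ → X), Tendsto u atTop (𝓝 x) →
    G x ≤ liminf (fun n => F n (u n)) atTop
  exists_recovery : ∀ x : X, ∃ u : ℕ → X, Tendsto u atTop (𝓝 x) ∧
    limsup (fun n => F n (u n)) atTop ≤ G x

end DFIV

end

/-!
Relative to a centred Gaussian `γ`, the entropy plus a multiple of the second moment is
`klDiv μ γ` up to a constant. The Donsker–Varadhan formula writes `klDiv μ γ` as a supremum of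
weakly continuous affine functions of `μ`, so that it is weakly lower semicontinuous and convex.

Stage I therefore has solutions by the direct method. Its convexity is strict in the output of the
network, so all solutions have the same outputs `ρ`-almost everywhere and the same `U₂`. When the
regularization vanishes, the Stage I objectives Γ-converge and their minimizers have bounded second
moments; by compactness and uniqueness of `U₂`, the Stage II error converges along every weakly
convergent sequence of `μ_x`. This reduces both claims to the case of a fidelity term that converges
continuously. There the lower bound follows from lower semicontinuity of the second moment, and a
recovery sequence is obtained by averaging `μ` over balls of radius `t n = σ n + 1 / (n + 1)`: the
entropy of the averages is at most `C - d * log (t n)`, and `σ n * log (t n)` tends to zero.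
-/

namespace DFIV

open Set TopologicalSpace InformationTheory
open scoped ENNReal NNReal BoundedContinuousFunction

section KullbackLeibler

theorem mul_sub_exp_le_klFun {t : ℝ} (ht : 0 ≤ t) (s : ℝ) :
    t * s - (Real.exp s - 1) ≤ klFun t := by
  rcases ht.eq_or_lt with rfl | ht
  · simpa [klFun] using (Real.exp_pos s).le
  · have h_exp : Real.exp s = t * Real.exp (s - Real.log t) := by
      rw [Real.exp_sub, Real.exp_log ht]
      field_simp
    have h_tangent := mul_le_mul_of_nonneg_left (Real.add_one_le_exp (s - Real.log t)) ht.le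
    rw [klFun, h_exp]
    linarith

/-- Truncation of `t` to the interval `[1/(n+1), n+1]`, on which `log` is bounded. -/
noncomputable def clip (n : ℕ) (t : ℝ) : ℝ := max (min t (n + 1)) (n + 1 : ℝ)⁻¹

theorem clip_pos (n : ℕ) (t : ℝ) : 0 < clip n t := lt_max_of_lt_right (by positivity)

theorem inv_natCast_add_one_le_one (n : ℕ) : (n + 1 : ℝ)⁻¹ ≤ 1 := inv_le_one_of_one_le₀ (by simp)

theorem clip_le (n : ℕ) (t : ℝ) : clip n t ≤ n + 1 :=
  max_le (min_le_right _ _) ((inv_natCast_add_one_le_one n).trans (by simp))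

theorem abs_log_clip_le (n : ℕ) (t : ℝ) : |Real.log (clip n t)| ≤ Real.log (n + 1) := by
  refine abs_le.2 ⟨?_, Real.log_le_log (clip_pos n t) (clip_le n t)⟩
  rw [← Real.log_inv]
  exact Real.log_le_log (by positivity) (le_max_right _ _)

theorem measurable_clip (n : ℕ) : Measurable (clip n) := by
  unfold clip
  fun_prop

theorem tendsto_clip {t : ℝ} (ht : 0 ≤ t) : Tendsto (fun n => clip n t) atTop (𝓝 t) := by
  have h_min : Tendsto (fun n : ℕ => min t (n + 1 : ℝ)) atTop (𝓝 t) := by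
    refine tendsto_const_nhds.congr' ?_
    filter_upwards [eventually_ge_atTop ⌈t⌉₊] with n hn
    exact (min_eq_left ((Nat.ceil_le.1 hn).trans (by simp))).symm
  have h_inv : Tendsto (fun n : ℕ => (n + 1 : ℝ)⁻¹) atTop (𝓝 0) := by
    simpa [one_div] using tendsto_one_div_add_atTop_nhds_zero_nat (𝕜 := ℝ)
  simpa [clip, max_eq_left ht] using h_min.max h_inv

-- `s ↦ t * s - (exp s - 1)` is concave and vanishes at `s = 0`, and `log (clip n t)` lies between
-- `0` and its maximizer `log t`.
theorem clip_sub_one_le_mul_log_clip (n : ℕ) (t : ℝ) :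
    clip n t - 1 ≤ t * Real.log (clip n t) := by
  have h_pos := clip_pos n t
  have h_log : clip n t - 1 ≤ clip n t * Real.log (clip n t) := by
    have := mul_sub_exp_le_klFun h_pos.le 0
    simp only [klFun, Real.exp_zero] at this
    linarith
  refine h_log.trans ?_
  rcases lt_trichotomy (clip n t) 1 with h | h | h
  · have h_le : t ≤ clip n t :=
      (min_le_iff.1 (le_max_left (min t (n + 1)) (n + 1 : ℝ)⁻¹)).resolve_right fun h_ge =>
        (h_ge.trans_lt h).not_ge (by simp)
    exact mul_le_mul_of_nonpos_right h_le (Real.log_nonpos h_pos.le h.le)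
  · simp [h]
  · have h_ge : clip n t ≤ t :=
      ((le_max_iff.1 le_rfl).resolve_right fun h_le =>
        (h.trans_le h_le).not_ge (inv_natCast_add_one_le_one n)).trans (min_le_left _ _)
    exact mul_le_mul_of_nonneg_right h_ge (Real.log_nonneg h.le)

theorem tendsto_mul_log_clip_sub_clip_add_one {t : ℝ} (ht : 0 ≤ t) :
    Tendsto (fun n => t * Real.log (clip n t) - clip n t + 1) atTop (𝓝 (klFun t)) := by
  have h_log : Tendsto (fun n => t * Real.log (clip n t)) atTop (𝓝 (t * Real.log t)) := by
    rcases ht.eq_or_lt with rfl | ht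
    · simp
    · exact ((tendsto_clip ht.le).log ht.ne').const_mul t
  convert (h_log.sub (tendsto_clip ht)).add_const 1 using 2
  rw [klFun]
  ring

section Duality

variable {X : Type*} [MeasurableSpace X] {μ γ : Measure X} [IsFiniteMeasure μ]

/-- The objective of the variational formula for `klDiv μ γ`, evaluated at the test function `φ`. -/
noncomputable def klDual (μ γ : Measure X) (φ : X → ℝ) : ℝ :=
  ∫ x, φ x ∂μ - ∫ x, (Real.exp (φ x) - 1) ∂γ

theorem integrable_of_abs_le {φ : X → ℝ} {N : ℝ} (h_meas : Measurable φ) (h_le : ∀ x, |φ x| ≤ N) :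
    Integrable φ μ :=
  .of_bound h_meas.aestronglyMeasurable N (.of_forall h_le)

theorem absolutelyContinuous_of_forall_klDual_le {r : ℝ}
    (h : ∀ (φ : X → ℝ) (N : ℝ), Measurable φ → (∀ x, |φ x| ≤ N) → klDual μ γ φ ≤ r) : μ ≪ γ := by
  refine Measure.AbsolutelyContinuous.mk fun s hs h_null => ?_
  have h_bound (n : ℕ) : n * μ.real s ≤ r := by
    have h_le := h (s.indicator fun _ => (n : ℝ)) n (measurable_const.indicator hs) fun x => by
      by_cases hx : x ∈ s <;> simp [hx]
    have h_exp : ∫ x, (Real.exp (s.indicator (fun _ => (n : ℝ)) x) - 1) ∂γ = 0 := by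
      refine integral_eq_zero_of_ae ?_
      filter_upwards [measure_eq_zero_iff_ae_notMem.1 h_null] with x hx
      simp [hx]
    rw [klDual, h_exp, integral_indicator_const _ hs, smul_eq_mul] at h_le
    linarith
  refine (measureReal_eq_zero_iff).1 (le_antisymm ?_ measureReal_nonneg)
  by_contra! h_pos
  obtain ⟨n, hn⟩ := exists_nat_gt (r / μ.real s)
  rw [div_lt_iff₀ h_pos] at hn
  exact hn.not_ge (h_bound n)

variable [IsFiniteMeasure γ]

theorem klDual_le_klDiv {φ : X → ℝ} (h_int : Integrable φ μ)
    (h_exp : Integrable (fun x => Real.exp (φ x)) γ) :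
    ENNReal.ofReal (klDual μ γ φ) ≤ klDiv μ γ := by
  by_cases h : klDiv μ γ = ∞
  · simp [h]
  obtain ⟨h_ac, h_llr⟩ := klDiv_ne_top_iff.1 h
  have h_smul := (integrable_rnDeriv_smul_iff h_ac).2 h_int
  have h_exp' : Integrable (fun x => Real.exp (φ x) - 1) γ := h_exp.sub (integrable_const 1)
  rw [ENNReal.ofReal_le_iff_le_toReal h, toReal_klDiv_eq_integral_klFun h_ac, klDual,
    ← integral_rnDeriv_smul h_ac, ← integral_sub h_smul h_exp']
  exact integral_mono (h_smul.sub h_exp') ((integrable_klFun_rnDeriv_iff h_ac).2 h_llr) fun x =>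
    mul_sub_exp_le_klFun ENNReal.toReal_nonneg _

theorem lintegral_rnDeriv_mul_log_clip (h_ac : μ ≪ γ) (n : ℕ) :
    ∫⁻ x, ENNReal.ofReal ((μ.rnDeriv γ x).toReal * Real.log (clip n (μ.rnDeriv γ x).toReal) -
      clip n (μ.rnDeriv γ x).toReal + 1) ∂γ =
    ENNReal.ofReal (klDual μ γ fun x => Real.log (clip n (μ.rnDeriv γ x).toReal)) := by
  have h_meas : Measurable fun x => clip n (μ.rnDeriv γ x).toReal :=
    (measurable_clip n).comp (Measure.measurable_rnDeriv μ γ).ennreal_toReal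
  have h_clip : Integrable (fun x => clip n (μ.rnDeriv γ x).toReal) γ :=
    integrable_of_abs_le h_meas fun x => (abs_of_pos (clip_pos n _)).trans_le (clip_le n _)
  have h_log := (integrable_rnDeriv_smul_iff h_ac).2
    (integrable_of_abs_le h_meas.log fun x => abs_log_clip_le n (μ.rnDeriv γ x).toReal)
  simp only [smul_eq_mul] at h_log
  have h_int : Integrable (fun x => (μ.rnDeriv γ x).toReal *
      Real.log (clip n (μ.rnDeriv γ x).toReal) - clip n (μ.rnDeriv γ x).toReal + 1) γ :=
    (h_log.sub h_clip).add (integrable_const 1)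
  rw [← ofReal_integral_eq_lintegral_ofReal h_int (.of_forall fun x => by
    have := clip_sub_one_le_mul_log_clip n (μ.rnDeriv γ x).toReal
    simp only [Pi.zero_apply]
    linarith)]
  simp only [klDual, Real.exp_log (clip_pos n _)]
  rw [← integral_rnDeriv_smul h_ac]
  simp only [smul_eq_mul]
  have h_clip' : Integrable (fun x => clip n (μ.rnDeriv γ x).toReal - 1) γ :=
    h_clip.sub (integrable_const 1)
  rw [← integral_sub h_log h_clip']
  congr 2 with x
  ring

-- The optimal test function is `log (dμ/dγ)`; its truncations are bounded, and Fatou's lemma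
-- removes the truncation.
theorem klDiv_le_of_forall_klDual_le {r : ℝ}
    (h : ∀ (φ : X → ℝ) (N : ℝ), Measurable φ → (∀ x, |φ x| ≤ N) → klDual μ γ φ ≤ r) :
    klDiv μ γ ≤ ENNReal.ofReal r := by
  have h_ac := absolutelyContinuous_of_forall_klDual_le h
  have h_meas : Measurable fun x => (μ.rnDeriv γ x).toReal :=
    (Measure.measurable_rnDeriv μ γ).ennreal_toReal
  have h_clip (n : ℕ) := (measurable_clip n).comp h_meas
  have h_lim (x : X) := (ENNReal.tendsto_ofReal (tendsto_mul_log_clip_sub_clip_add_one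
    (ENNReal.toReal_nonneg (a := μ.rnDeriv γ x)))).liminf_eq
  rw [klDiv_eq_lintegral_klFun_of_ac h_ac]
  simp only [← h_lim]
  refine (lintegral_liminf_le fun n => ?_).trans
    (liminf_le_of_frequently_le' (.of_forall fun n => ?_))
  · exact (((h_meas.mul (h_clip n).log).sub (h_clip n)).add_const 1).ennreal_ofReal
  · rw [lintegral_rnDeriv_mul_log_clip h_ac]
    exact ENNReal.ofReal_le_ofReal (h _ _ (h_clip n).log fun x => abs_log_clip_le n _)

theorem tendsto_klDual {φ : X → ℝ} {ψ : ℕ → X → ℝ} {N : ℝ} (h_meas : ∀ n, Measurable (ψ n))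
    (h_le : ∀ n x, |ψ n x| ≤ N)
    (h_lim : ∀ᵐ x ∂(μ + γ), Tendsto (fun n => ψ n x) atTop (𝓝 (φ x))) :
    Tendsto (fun n => klDual μ γ (ψ n)) atTop (𝓝 (klDual μ γ φ)) := by
  rw [ae_add_measure_iff] at h_lim
  refine (tendsto_integral_of_dominated_convergence (fun _ => N)
    (fun n => (h_meas n).aestronglyMeasurable) (integrable_const N)
    (fun n => .of_forall (h_le n)) h_lim.1).sub
    (tendsto_integral_of_dominated_convergence (fun _ => Real.exp N + 1)
    (fun n => ((h_meas n).exp.sub_const 1).aestronglyMeasurable) (integrable_const _)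
    (fun n => .of_forall fun x => ?_) ?_)
  · refine (norm_sub_le _ _).trans (add_le_add ?_ (by simp))
    simpa using (abs_le.1 (h_le n x)).2
  · filter_upwards [h_lim.2] with x hx
    exact (Real.continuous_exp.tendsto _ |>.comp hx).sub_const 1

variable [TopologicalSpace X]

theorem exists_boundedContinuous_tendsto_ae [NormalSpace X] [BorelSpace X] {ν : Measure X}
    [IsFiniteMeasure ν] [ν.WeaklyRegular] {φ : X → ℝ} {N : ℝ} (h_meas : Measurable φ)
    (h_le : ∀ x, |φ x| ≤ N) :
    ∃ ψ : ℕ → X →ᵇ ℝ, (∀ n x, |ψ n x| ≤ N) ∧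
      ∀ᵐ x ∂ν, Tendsto (fun n => ψ n x) atTop (𝓝 (φ x)) := by
  have h_mem : MemLp φ 1 ν := MemLp.of_bound h_meas.aestronglyMeasurable N (.of_forall h_le)
  choose g hg _ using fun n : ℕ => h_mem.exists_boundedContinuous_eLpNorm_sub_le
    ENNReal.one_ne_top (ε := (n + 1 : ENNReal)⁻¹) (by simp)
  have h_L1 : Tendsto (fun n => eLpNorm ((g n : X → ℝ) - φ) 1 ν) atTop (𝓝 0) :=
    tendsto_of_tendsto_of_tendsto_of_le_of_le tendsto_const_nhds
      (by simpa using (tendsto_add_atTop_iff_nat 1).2 ENNReal.tendsto_inv_nat_nhds_zero)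
      (fun _ => zero_le) fun n => by simpa [eLpNorm_sub_comm] using hg n
  obtain ⟨k, -, hk⟩ := (tendstoInMeasure_of_tendsto_eLpNorm one_ne_zero
    (fun n => (g n).continuous.aestronglyMeasurable) h_meas.aestronglyMeasurable
    h_L1).exists_seq_tendsto_ae
  have h_trunc (n : ℕ) (x : X) : |max (min (g (k n) x) N) (-N)| ≤ N :=
    abs_le.2 ⟨le_max_right _ _, max_le (min_le_right _ _)
      (neg_le_self ((abs_nonneg _).trans (h_le x)))⟩
  refine ⟨fun n => .ofNormedAddCommGroup (fun x => max (min (g (k n) x) N) (-N)) (by fun_prop) N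
    (h_trunc n), h_trunc, ?_⟩
  filter_upwards [hk] with x hx
  have h_lim := (hx.min (tendsto_const_nhds (x := N))).max (tendsto_const_nhds (x := -N))
  rwa [min_eq_left (abs_le.1 (h_le x)).2, max_eq_left (abs_le.1 (h_le x)).1] at h_lim

theorem integrable_exp_boundedContinuous [BorelSpace X] (φ : X →ᵇ ℝ) :
    Integrable (fun x => Real.exp (φ x)) γ :=
  integrable_of_abs_le (by fun_prop) (N := Real.exp ‖φ‖) fun x => by
    simpa using (le_abs_self _).trans (φ.norm_coe_le_norm x)

theorem klDiv_eq_iSup_boundedContinuous [PseudoMetrizableSpace X] [BorelSpace X] :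
    klDiv μ γ = ⨆ φ : X →ᵇ ℝ, ENNReal.ofReal (klDual μ γ φ) := by
  let _ := pseudoMetrizableSpacePseudoMetric X
  refine le_antisymm ?_ (iSup_le fun φ => klDual_le_klDiv (φ.integrable _) ?_)
  · by_cases h_top : ⨆ φ : X →ᵇ ℝ, ENNReal.ofReal (klDual μ γ φ) = ∞
    · simp [h_top]
    rw [← ENNReal.ofReal_toReal h_top]
    refine klDiv_le_of_forall_klDual_le fun φ N h_meas h_le => ?_
    obtain ⟨ψ, h_ψ_le, h_lim⟩ := exists_boundedContinuous_tendsto_ae (ν := μ + γ) h_meas h_le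
    refine le_of_tendsto' (tendsto_klDual (fun n => (ψ n).continuous.measurable) h_ψ_le h_lim)
      fun n => (ENNReal.ofReal_le_iff_le_toReal h_top).1 (le_iSup
        (fun φ : X →ᵇ ℝ => ENNReal.ofReal (klDual μ γ φ)) (ψ n))
  · exact integrable_exp_boundedContinuous φ

theorem lowerSemicontinuous_klDiv_left [PseudoMetrizableSpace X] [BorelSpace X] :
    LowerSemicontinuous fun μ : ProbabilityMeasure X => klDiv (μ : Measure X) γ := by
  simp only [klDiv_eq_iSup_boundedContinuous]
  refine lowerSemicontinuous_iSup fun φ => Continuous.lowerSemicontinuous ?_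
  exact ENNReal.continuous_ofReal.comp
    ((ProbabilityMeasure.continuous_integral_boundedContinuousFunction φ).sub continuous_const)

theorem klDiv_add_smul_le [PseudoMetrizableSpace X] [BorelSpace X] {ν : Measure X}
    [IsFiniteMeasure ν] {a b : ℝ≥0} (hab : a + b = 1) :
    klDiv (a • μ + b • ν) γ ≤ a * klDiv μ γ + b * klDiv ν γ := by
  rw [klDiv_eq_iSup_boundedContinuous]
  refine iSup_le fun φ => ?_
  have h_eq : klDual (a • μ + b • ν) γ φ = a * klDual μ γ φ + b * klDual ν γ φ := by
    have hb : (b : ℝ) = 1 - a := by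
      rw [eq_sub_iff_add_eq']
      exact_mod_cast hab
    rw [klDual, integral_add_measure (φ.integrable _) (φ.integrable _),
      integral_smul_nnreal_measure, integral_smul_nnreal_measure, klDual, klDual,
      NNReal.smul_def, NNReal.smul_def, hb]
    simp only [smul_eq_mul]
    ring
  rw [h_eq]
  refine ENNReal.ofReal_add_le.trans (add_le_add ?_ ?_) <;>
  · rw [ENNReal.ofReal_mul NNReal.zero_le_coe, ENNReal.ofReal_coe_nnreal]
    gcongr
    exact klDual_le_klDiv (φ.integrable _) (integrable_exp_boundedContinuous φ)

end Duality

end KullbackLeibler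

section Moments

theorem lowerSemicontinuous_lintegral {X : Type*} [TopologicalSpace X] [MeasurableSpace X]
    [OpensMeasurableSpace X] {f : X → ℝ≥0} (hf : Continuous f) :
    LowerSemicontinuous fun μ : ProbabilityMeasure X => ∫⁻ x, f x ∂(μ : Measure X) := by
  have h_sup (μ : ProbabilityMeasure X) :
      ∫⁻ x, f x ∂(μ : Measure X) = ⨆ n : ℕ, ∫⁻ x, (min (f x) n : ℝ≥0) ∂(μ : Measure X) := by
    rw [← lintegral_iSup (fun n => (hf.min continuous_const).measurable.coe_nnreal_ennreal)
      fun m n hmn x => by gcongr]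
    congr with x
    simp only [ENNReal.coe_min, ← inf_iSup_eq, ENNReal.coe_natCast, ENNReal.iSup_natCast,
      inf_top_eq]
  simp only [h_sup]
  refine lowerSemicontinuous_iSup fun n => Continuous.lowerSemicontinuous ?_
  exact ProbabilityMeasure.continuous_lintegral_boundedContinuousFunction
    (BoundedContinuousFunction.mkOfBound ⟨fun x => min (f x) n, by fun_prop⟩ n fun x y => by
      simpa [NNReal.dist_eq] using
        abs_sub_le_of_nonneg_of_le (by positivity) (by simp) (by positivity) (by simp))

variable {E : Type*} [NormedAddCommGroup E] [MeasurableSpace E] [BorelSpace E]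

theorem measure_lt_norm_le_lintegral_div {μ : Measure E} {r : ℝ} (hr : 0 < r) :
    μ {x | r < ‖x‖} ≤ (∫⁻ x, ‖x‖ₑ ^ 2 ∂μ) / ENNReal.ofReal r ^ 2 := by
  refine (measure_mono fun x (hx : r < ‖x‖) => ?_).trans
    (meas_ge_le_lintegral_div (by fun_prop) (by simpa using hr) (by simp))
  simp only [mem_ofPred_eq]
  gcongr
  rw [← ofReal_norm]
  exact ENNReal.ofReal_le_ofReal hx.le

theorem isClosed_lintegral_sq_enorm_le (C : ℝ≥0∞) :
    IsClosed {μ : ProbabilityMeasure E | ∫⁻ x, ‖x‖ₑ ^ 2 ∂(μ : Measure E) ≤ C} :=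
  (lowerSemicontinuous_lintegral (continuous_nnnorm.pow 2)).isClosed_preimage C

theorem isCompact_lintegral_sq_enorm_le [ProperSpace E] {C : ℝ≥0∞} (hC : C ≠ ∞) :
    IsCompact {μ : ProbabilityMeasure E | ∫⁻ x, ‖x‖ₑ ^ 2 ∂(μ : Measure E) ≤ C} := by
  rw [← (isClosed_lintegral_sq_enorm_le C).closure_eq]
  refine isCompact_closure_of_isTightMeasureSet (isTightMeasureSet_of_tendsto_measure_norm_gt ?_)
  have h_lim : Tendsto (fun r => C / ENNReal.ofReal r ^ 2) atTop (𝓝 0) := by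
    simpa using ENNReal.Tendsto.const_div ((ENNReal.continuous_pow 2).tendsto _ |>.comp
      ENNReal.tendsto_ofReal_atTop) (Or.inr hC)
  refine tendsto_of_tendsto_of_tendsto_of_le_of_le' tendsto_const_nhds h_lim
    (.of_forall fun _ => zero_le) ?_
  filter_upwards [eventually_gt_atTop 0] with r hr
  refine iSup₂_le ?_
  rintro _ ⟨μ, hμ, rfl⟩
  exact (measure_lt_norm_le_lintegral_div hr).trans (ENNReal.div_le_div_right hμ _)

end Moments

section SecondMoment

variable {d : ℕ}

instance (μ : P2 d) : IsProbabilityMeasure μ.toMeasure := μ.1.2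

instance : FirstCountableTopology (P2 d) := IsEmbedding.subtypeVal.firstCountableTopology

theorem P2.integrable_sq_norm (μ : P2 d) : Integrable (fun x => ‖x‖ ^ 2) μ.toMeasure := μ.2

theorem P2.tendsto_integral {ι : Type*} {l : Filter ι} {u : ι → P2 d} {μ : P2 d}
    (hu : Tendsto u l (𝓝 μ)) {φ : Eucl d → ℝ} (hφ : Continuous φ) {N : ℝ} (hN : ∀ x, |φ x| ≤ N) :
    Tendsto (fun i => ∫ x, φ x ∂(u i).toMeasure) l (𝓝 (∫ x, φ x ∂μ.toMeasure)) :=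
  ProbabilityMeasure.tendsto_iff_forall_integral_tendsto.1 (tendsto_subtype_rng.1 hu)
    (BoundedContinuousFunction.ofNormedAddCommGroup φ hφ N hN)

theorem secondMoment_nonneg (μ : P2 d) : 0 ≤ secondMoment μ :=
  integral_nonneg fun _ => by positivity

theorem lintegral_sq_enorm_eq_ofReal (μ : P2 d) :
    ∫⁻ x, ‖x‖ₑ ^ 2 ∂μ.toMeasure = ENNReal.ofReal (secondMoment μ) := by
  rw [secondMoment, ofReal_integral_eq_lintegral_ofReal μ.integrable_sq_norm
    (.of_forall fun _ => by positivity)]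
  simp only [ENNReal.ofReal_pow (norm_nonneg _), ofReal_norm]

theorem image_val_secondMoment_le {C : ℝ} (hC : 0 ≤ C) :
    Subtype.val '' {μ : P2 d | secondMoment μ ≤ C} =
      {μ : ProbabilityMeasure (Eucl d) | ∫⁻ x, ‖x‖ₑ ^ 2 ∂(μ : Measure (Eucl d)) ≤
        ENNReal.ofReal C} := by
  ext μ
  constructor
  · rintro ⟨ν, hν, rfl⟩
    exact (lintegral_sq_enorm_eq_ofReal ν).trans_le (ENNReal.ofReal_le_ofReal hν)
  · intro (hμ : ∫⁻ x, ‖x‖ₑ ^ 2 ∂(μ : Measure (Eucl d)) ≤ _)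
    have h_int : Integrable (fun x => ‖x‖ ^ 2) (μ : Measure (Eucl d)) := by
      refine ⟨by fun_prop, ?_⟩
      simpa [HasFiniteIntegral] using hμ.trans_lt ENNReal.ofReal_lt_top
    let ν : P2 d := ⟨μ, h_int⟩
    exact ⟨ν, (ENNReal.ofReal_le_ofReal_iff hC).1
      ((lintegral_sq_enorm_eq_ofReal ν).symm.trans_le hμ), rfl⟩

theorem secondMoment_le_eq_empty {C : ℝ} (hC : C < 0) : {μ : P2 d | secondMoment μ ≤ C} = ∅ :=
  eq_empty_of_forall_notMem fun μ hμ => (hC.trans_le (secondMoment_nonneg μ)).not_ge hμ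

theorem isCompact_secondMoment_le (C : ℝ) : IsCompact {μ : P2 d | secondMoment μ ≤ C} := by
  rcases lt_or_ge C 0 with hC | hC
  · simp only [secondMoment_le_eq_empty hC, isCompact_empty]
  · rw [Subtype.isCompact_iff, image_val_secondMoment_le hC]
    exact isCompact_lintegral_sq_enorm_le ENNReal.ofReal_ne_top

theorem lowerSemicontinuous_secondMoment : LowerSemicontinuous (secondMoment (d := d)) :=
  lowerSemicontinuous_iff_isClosed_preimage.2 fun C => (isCompact_secondMoment_le C).isClosed

theorem exists_val_eq_of_tendsto {m : ℕ → P2 d} {C : ℝ} (hm : ∀ n, secondMoment (m n) ≤ C)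
    {μ : ProbabilityMeasure (Eucl d)} (hμ : Tendsto (fun n => (m n).1) atTop (𝓝 μ)) :
    ∃ ν : P2 d, ν.1 = μ := by
  have hC : 0 ≤ C := (secondMoment_nonneg _).trans (hm 0)
  have h_mem : μ ∈ Subtype.val '' {μ : P2 d | secondMoment μ ≤ C} := by
    rw [image_val_secondMoment_le hC]
    refine (isClosed_lintegral_sq_enorm_le _).mem_of_tendsto hμ (.of_forall fun n => ?_)
    rw [← image_val_secondMoment_le hC]
    exact mem_image_of_mem _ (hm n)
  obtain ⟨ν, -, hν⟩ := h_mem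
  exact ⟨ν, hν⟩

end SecondMoment

section Entropy

variable {d : ℕ}

theorem integrable_llr_tilted_right_iff {X : Type*} [MeasurableSpace X] {μ ν : Measure X}
    [IsFiniteMeasure μ] [SigmaFinite ν] {f : X → ℝ} (hμν : μ ≪ ν) (hfμ : Integrable f μ)
    (hfν : Integrable (fun x => Real.exp (f x)) ν) :
    Integrable (llr μ (ν.tilted f)) μ ↔ Integrable (llr μ ν) μ := by
  rw [integrable_congr (llr_tilted_right hμν hfν)]
  exact integrable_add_iff_integrable_right (hfμ.neg.add (integrable_const _))

theorem integrable_exp_neg_mul_sq_norm {V : Type*} [NormedAddCommGroup V] [InnerProductSpace ℝ V]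
    [FiniteDimensional ℝ V] [MeasurableSpace V] [BorelSpace V] {a : ℝ} (ha : 0 < a) :
    Integrable fun x : V => Real.exp (-a * ‖x‖ ^ 2) :=
  .of_integral_ne_zero (by rw [GaussianFourier.integral_rexp_neg_mul_sq_norm ha]; positivity)

/-- The centred Gaussian measure on `ℝ^d` with density proportional to `exp (-a‖x‖²)`. Its purpose
is to make the entropy a relative entropy, up to the second moment. -/
noncomputable def gaussian (d : ℕ) (a : ℝ) : Measure (Eucl d) :=
  volume.tilted fun x => -a * ‖x‖ ^ 2

theorem isProbabilityMeasure_gaussian {a : ℝ} (ha : 0 < a) :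
    IsProbabilityMeasure (gaussian d a) :=
  isProbabilityMeasure_tilted (integrable_exp_neg_mul_sq_norm ha)

theorem Ent_eq_integral_llr {μ : P2 d} (hμ : μ.toMeasure ≪ volume)
    (h_int : Integrable (llr μ.toMeasure volume) μ.toMeasure) :
    Ent μ = ((∫ x, llr μ.toMeasure volume x ∂μ.toMeasure : ℝ) : EReal) := by
  rw [Ent, if_pos ⟨hμ, (integrable_rnDeriv_mul_log_iff hμ).2 h_int⟩, ← integral_rnDeriv_mul_log hμ]
  rfl

theorem Ent_eq_top {μ : P2 d}
    (h : ¬(μ.toMeasure ≪ volume ∧ Integrable (llr μ.toMeasure volume) μ.toMeasure)) :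
    Ent μ = ⊤ :=
  if_neg fun h' => h ⟨h'.1, (integrable_rnDeriv_mul_log_iff h'.1).1 h'.2⟩

theorem Ent_ne_bot (μ : P2 d) : Ent μ ≠ ⊥ := by
  rw [Ent]
  split_ifs
  · exact EReal.coe_ne_bot _
  · exact top_ne_bot

theorem coe_klDiv_gaussian {a : ℝ} (ha : 0 < a) (μ : P2 d) :
    (klDiv μ.toMeasure (gaussian d a) : EReal) = Ent μ +
      ((a * secondMoment μ + Real.log (∫ x : Eucl d, Real.exp (-a * ‖x‖ ^ 2)) : ℝ) : EReal) := by
  have := isProbabilityMeasure_gaussian (d := d) ha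
  have h_exp := integrable_exp_neg_mul_sq_norm (V := Eucl d) ha
  have h_ac : μ.toMeasure ≪ gaussian d a ↔ μ.toMeasure ≪ volume :=
    ⟨fun h => h.trans (tilted_absolutelyContinuous _ _),
      fun h => h.trans (absolutelyContinuous_tilted h_exp)⟩
  have h_sq : Integrable (fun x => -a * ‖x‖ ^ 2) μ.toMeasure := μ.integrable_sq_norm.const_mul _
  have h_llr (h : μ.toMeasure ≪ volume) := integrable_llr_tilted_right_iff h h_sq h_exp
  by_cases h : μ.toMeasure ≪ volume ∧ Integrable (llr μ.toMeasure volume) μ.toMeasure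
  · have h_fin := klDiv_ne_top_iff.2 ⟨h_ac.2 h.1, (h_llr h.1).2 h.2⟩
    rw [Ent_eq_integral_llr h.1 h.2, ← EReal.coe_ennreal_toReal h_fin,
      toReal_klDiv_of_measure_eq (h_ac.2 h.1) (by simp), ← EReal.coe_add, EReal.coe_eq_coe_iff,
      gaussian, integral_llr_tilted_right h.1 h_sq h_exp h.2, integral_const_mul, secondMoment]
    ring
  · rw [Ent_eq_top h, EReal.top_add_coe, EReal.coe_ennreal_eq_top_iff]
    refine not_not.1 (klDiv_ne_top_iff.not.2 fun h' => h ?_)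
    exact ⟨h_ac.1 h'.1, (h_llr (h_ac.1 h'.1)).1 h'.2⟩

theorem Ent_eq_coe_klDiv_add {a : ℝ} (ha : 0 < a) (μ : P2 d) :
    Ent μ = (klDiv μ.toMeasure (gaussian d a) : EReal) +
      ((-(a * secondMoment μ) - Real.log (∫ x : Eucl d, Real.exp (-a * ‖x‖ ^ 2)) : ℝ) : EReal) := by
  rw [coe_klDiv_gaussian ha, add_assoc, ← EReal.coe_add]
  ring_nf
  simp

theorem exists_neg_mul_secondMoment_sub_le_Ent (d : ℕ) {a : ℝ} (ha : 0 < a) :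
    ∃ K : ℝ, ∀ μ : P2 d, ((-(a * secondMoment μ) - K : ℝ) : EReal) ≤ Ent μ := by
  refine ⟨Real.log (∫ x : Eucl d, Real.exp (-a * ‖x‖ ^ 2)), fun μ => ?_⟩
  rw [Ent_eq_coe_klDiv_add ha μ]
  exact le_add_of_nonneg_left (EReal.coe_ennreal_nonneg _)

theorem lowerSemicontinuous_coe_add {X : Type*} [TopologicalSpace X] {f : X → ℝ} {g : X → EReal}
    (hf : LowerSemicontinuous f) (hg : LowerSemicontinuous g) :
    LowerSemicontinuous fun x => (f x : EReal) + g x :=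
  (continuous_coe_real_ereal.comp_lowerSemicontinuous hf EReal.coe_strictMono.monotone).add' hg
    fun _ => EReal.continuousAt_add (.inl (EReal.coe_ne_top _)) (.inl (EReal.coe_ne_bot _))

theorem lowerSemicontinuous_mul_secondMoment_add_Ent {a : ℝ} (ha : 0 < a) :
    LowerSemicontinuous fun μ : P2 d => ((a * secondMoment μ : ℝ) : EReal) + Ent μ := by
  have := isProbabilityMeasure_gaussian (d := d) ha
  have h_kl : LowerSemicontinuous fun μ : P2 d => (klDiv μ.toMeasure (gaussian d a) : EReal) :=
    continuous_coe_ennreal_ereal.comp_lowerSemicontinuous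
      (lowerSemicontinuous_klDiv_left.comp continuous_subtype_val)
      fun _ _ => EReal.coe_ennreal_le_coe_ennreal_iff.2
  convert lowerSemicontinuous_coe_add (lowerSemicontinuous_const
    (z := -Real.log (∫ x : Eucl d, Real.exp (-a * ‖x‖ ^ 2)))) h_kl using 2 with μ
  rw [Ent_eq_coe_klDiv_add ha μ, add_left_comm, ← EReal.coe_add, add_comm]
  ring_nf

end Entropy

section Mixture

variable {d : ℕ}

/-- The mixture `(μ + ν) / 2`. -/
noncomputable def P2.mid (μ ν : P2 d) : P2 d :=
  ⟨⟨(2⁻¹ : ℝ≥0) • μ.toMeasure + (2⁻¹ : ℝ≥0) • ν.toMeasure,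
    ⟨by simp [ENNReal.smul_def, ENNReal.inv_two_add_inv_two]⟩⟩,
    (μ.integrable_sq_norm.smul_measure_nnreal).add_measure
      (ν.integrable_sq_norm.smul_measure_nnreal)⟩

theorem P2.integral_mid (μ ν : P2 d) {φ : Eucl d → ℝ} (hμ : Integrable φ μ.toMeasure)
    (hν : Integrable φ ν.toMeasure) :
    ∫ x, φ x ∂(P2.mid μ ν).toMeasure = (∫ x, φ x ∂μ.toMeasure + ∫ x, φ x ∂ν.toMeasure) / 2 := by
  change ∫ x, φ x ∂((2⁻¹ : ℝ≥0) • μ.toMeasure + (2⁻¹ : ℝ≥0) • ν.toMeasure) = _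
  rw [integral_add_measure hμ.smul_measure_nnreal hν.smul_measure_nnreal,
    integral_smul_nnreal_measure, integral_smul_nnreal_measure]
  simp only [NNReal.smul_def, NNReal.coe_inv, NNReal.coe_ofNat, smul_eq_mul]
  ring

theorem secondMoment_mid (μ ν : P2 d) :
    secondMoment (P2.mid μ ν) = (secondMoment μ + secondMoment ν) / 2 :=
  P2.integral_mid μ ν μ.integrable_sq_norm ν.integrable_sq_norm

theorem Ent_mid_le {μ ν : P2 d} {e e' : ℝ} (hμ : Ent μ = e) (hν : Ent ν = e') :
    Ent (P2.mid μ ν) ≤ (((e + e') / 2 : ℝ) : EReal) := by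
  have := isProbabilityMeasure_gaussian (d := d) one_pos
  have h_kl : klDiv (P2.mid μ ν).toMeasure (gaussian d 1) ≤
      (2⁻¹ : ℝ≥0) * klDiv μ.toMeasure (gaussian d 1) +
        (2⁻¹ : ℝ≥0) * klDiv ν.toMeasure (gaussian d 1) :=
    klDiv_add_smul_le (by rw [← two_mul, mul_inv_cancel₀ two_ne_zero])
  replace h_kl := EReal.coe_ennreal_le_coe_ennreal_iff.2 h_kl
  rw [EReal.coe_ennreal_add, EReal.coe_ennreal_mul, EReal.coe_ennreal_mul,
    coe_klDiv_gaussian one_pos, coe_klDiv_gaussian one_pos, coe_klDiv_gaussian one_pos, hμ, hν,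
    secondMoment_mid] at h_kl
  refine ((EReal.addLECancellable_coe _).add_le_add_iff_right).1 (h_kl.trans_eq ?_)
  simp only [EReal.coe_nnreal_eq_coe_real, NNReal.coe_inv, NNReal.coe_ofNat, ← EReal.coe_add,
    ← EReal.coe_mul]
  congr 1
  ring

end Mixture

section Smoothing

variable {d : ℕ}

theorem density_nonneg (μ : P2 d) (x : Eucl d) : 0 ≤ density μ x := ENNReal.toReal_nonneg

theorem integrable_density_mul {μ : P2 d} (hμ : μ.toMeasure ≪ volume) {φ : Eucl d → ℝ}
    (hφ : Integrable φ μ.toMeasure) : Integrable fun x => density μ x * φ x :=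
  (integrable_rnDeriv_smul_iff hμ).2 hφ

theorem ae_density_le_of_le_smul {μ : P2 d} {k : ℝ} (hk : 0 ≤ k)
    (h : μ.toMeasure ≤ ENNReal.ofReal k • volume) : ∀ᵐ x : Eucl d, density μ x ≤ k := by
  have h_rnDeriv : μ.toMeasure.rnDeriv volume ≤ᵐ[volume] fun _ => ENNReal.ofReal k := by
    refine ae_le_of_forall_setLIntegral_le_of_sigmaFinite (Measure.measurable_rnDeriv _ _)
      fun s _ _ => ?_
    rw [setLIntegral_const]
    exact (Measure.setLIntegral_rnDeriv_le s).trans (h s)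
  filter_upwards [h_rnDeriv] with x hx
  exact ENNReal.toReal_le_of_le_ofReal hk hx

theorem Ent_le_log_of_le_smul {μ : P2 d} {k : ℝ} (hk : 0 < k)
    (h : μ.toMeasure ≤ ENNReal.ofReal k • volume) : Ent μ ≤ (Real.log k : EReal) := by
  have hμ : μ.toMeasure ≪ volume := Measure.absolutelyContinuous_of_le_smul h
  have h_upper : ∀ᵐ x : Eucl d,
      density μ x * Real.log (density μ x) ≤ density μ x * Real.log k := by
    filter_upwards [ae_density_le_of_le_smul hk.le h] with x hx
    rcases (density_nonneg μ x).eq_or_lt with h0 | h0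
    · simp [← h0]
    · exact mul_le_mul_of_nonneg_left (Real.log_le_log h0 hx) h0.le
  have h_lower (x : Eucl d) : density μ x * (1 - ‖x‖ ^ 2) - Real.exp (-1 * ‖x‖ ^ 2) ≤
      density μ x * Real.log (density μ x) := by
    have := mul_sub_exp_le_klFun (density_nonneg μ x) (-1 * ‖x‖ ^ 2)
    rw [klFun] at this
    linarith
  have h_upper_int := integrable_density_mul hμ (integrable_const (Real.log k))
  have h_int : Integrable fun x => density μ x * Real.log (density μ x) :=
    integrable_of_le_of_le (by unfold density; fun_prop) (.of_forall h_lower) h_upper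
      ((integrable_density_mul hμ ((integrable_const 1).sub μ.integrable_sq_norm)).sub
        (integrable_exp_neg_mul_sq_norm one_pos)) h_upper_int
  rw [Ent, if_pos ⟨hμ, h_int⟩, EReal.coe_le_coe_iff]
  calc ∫ x, density μ x * Real.log (density μ x)
      ≤ ∫ x, density μ x * Real.log k := integral_mono_ae h_int h_upper_int h_upper
    _ = Real.log k := by
      simpa [density] using integral_rnDeriv_smul hμ (f := fun _ => Real.log k)

/-- The uniform distribution on the unit ball of `ℝ^d`. -/
noncomputable def unif (d : ℕ) : Measure (Eucl d) :=
  ProbabilityTheory.cond volume (Metric.ball 0 1)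

theorem volume_unitBall_ne_zero : volume (Metric.ball (0 : Eucl d) 1) ≠ 0 :=
  (Metric.measure_ball_pos _ _ one_pos).ne'

instance : IsProbabilityMeasure (unif d) :=
  ProbabilityTheory.cond_isProbabilityMeasure_of_finite volume_unitBall_ne_zero
    measure_ball_lt_top.ne

theorem ae_norm_le_one_unif : ∀ᵐ u ∂unif d, ‖u‖ ≤ 1 := by
  filter_upwards [ProbabilityTheory.ae_cond_mem measurableSet_ball] with u hu
  exact (mem_ball_zero_iff.1 hu).le

theorem unif_le_smul_volume :
    unif d ≤ (volume (Metric.ball (0 : Eucl d) 1))⁻¹ • volume := by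
  unfold unif ProbabilityTheory.cond
  gcongr
  exact Measure.restrict_le_self

theorem sq_norm_add_smul_le {E : Type*} [SeminormedAddCommGroup E] [NormedSpace ℝ E] (x : E)
    {u : E} (hu : ‖u‖ ≤ 1) (t : ℝ) : ‖x + t • u‖ ^ 2 ≤ 2 * ‖x‖ ^ 2 + 2 * t ^ 2 := by
  have h_norm : ‖x + t • u‖ ≤ ‖x‖ + |t| := by
    grw [norm_add_le, norm_smul, hu, mul_one, Real.norm_eq_abs]
  grw [h_norm, add_sq_le, sq_abs, mul_add]

theorem ae_sq_norm_add_smul_le (μ : P2 d) (t : ℝ) : ∀ᵐ p ∂(μ.toMeasure.prod (unif d)),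
    ‖p.1 + t • p.2‖ ^ 2 ≤ 2 * ‖p.1‖ ^ 2 + 2 * t ^ 2 := by
  filter_upwards [Measure.quasiMeasurePreserving_snd.ae ae_norm_le_one_unif] with p hp
  exact sq_norm_add_smul_le p.1 hp t

theorem integrable_two_mul_sq_norm_fst_add (μ : P2 d) (c : ℝ) :
    Integrable (fun p : Eucl d × Eucl d => 2 * ‖p.1‖ ^ 2 + c) (μ.toMeasure.prod (unif d)) :=
  ((μ.integrable_sq_norm.comp_fst (unif d)).const_mul 2).add (integrable_const _)

theorem integrable_sq_norm_add_smul (μ : P2 d) (t : ℝ) :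
    Integrable (fun p : Eucl d × Eucl d => ‖p.1 + t • p.2‖ ^ 2) (μ.toMeasure.prod (unif d)) := by
  refine (integrable_two_mul_sq_norm_fst_add μ (2 * t ^ 2)).mono' (by fun_prop) ?_
  filter_upwards [ae_sq_norm_add_smul_le μ t] with p hp
  rwa [Real.norm_of_nonneg (by positivity)]

theorem measurable_add_smul (t : ℝ) : Measurable fun p : Eucl d × Eucl d => p.1 + t • p.2 := by
  fun_prop

/-- The law of `X + t U`, where `X` has law `μ` and `U` is independent of `X` and uniformly
distributed on the unit ball. -/
noncomputable def P2.smooth (μ : P2 d) (t : ℝ) : P2 d :=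
  ⟨⟨(μ.toMeasure.prod (unif d)).map fun p => p.1 + t • p.2,
    Measure.isProbabilityMeasure_map (measurable_add_smul t).aemeasurable⟩,
    (integrable_map_measure (by fun_prop) (measurable_add_smul t).aemeasurable).2
      (integrable_sq_norm_add_smul μ t)⟩

theorem P2.integral_smooth (μ : P2 d) (t : ℝ) {φ : Eucl d → ℝ} (hφ : Continuous φ) :
    ∫ x, φ x ∂(μ.smooth t).toMeasure =
      ∫ p, φ (p.1 + t • p.2) ∂(μ.toMeasure.prod (unif d)) :=
  integral_map (measurable_add_smul t).aemeasurable hφ.aestronglyMeasurable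

theorem P2.tendsto_integral_smooth (μ : P2 d) {t : ℕ → ℝ} (ht : Tendsto t atTop (𝓝 0))
    {φ : Eucl d → ℝ} (hφ : Continuous φ) {g : Eucl d × Eucl d → ℝ}
    (hg : Integrable g (μ.toMeasure.prod (unif d)))
    (h_le : ∀ᶠ n in atTop, ∀ᵐ p ∂(μ.toMeasure.prod (unif d)), |φ (p.1 + t n • p.2)| ≤ g p) :
    Tendsto (fun n => ∫ x, φ x ∂(μ.smooth (t n)).toMeasure) atTop
      (𝓝 (∫ x, φ x ∂μ.toMeasure)) := by
  have h_fst : ∫ x, φ x ∂μ.toMeasure = ∫ p, φ p.1 ∂(μ.toMeasure.prod (unif d)) := by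
    simp only [integral_fun_fst, probReal_univ, one_smul]
  simp only [P2.integral_smooth μ _ hφ, h_fst]
  refine tendsto_integral_filter_of_dominated_convergence g (.of_forall fun n => ?_) h_le hg
    (.of_forall fun p => ?_)
  · exact (by fun_prop : Continuous fun p : Eucl d × Eucl d =>
      φ (p.1 + t n • p.2)).aestronglyMeasurable
  · refine (hφ.tendsto _).comp ?_
    simpa using (ht.smul_const p.2).const_add p.1

theorem P2.tendsto_smooth (μ : P2 d) {t : ℕ → ℝ} (ht : Tendsto t atTop (𝓝 0)) :
    Tendsto (fun n => μ.smooth (t n)) atTop (𝓝 μ) :=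
  tendsto_subtype_rng.2 <| ProbabilityMeasure.tendsto_iff_forall_integral_tendsto.2 fun φ =>
    P2.tendsto_integral_smooth μ ht φ.continuous (integrable_const ‖φ‖)
      (.of_forall fun _ => .of_forall fun _ => φ.norm_coe_le_norm _)

theorem P2.tendsto_secondMoment_smooth (μ : P2 d) {t : ℕ → ℝ} (ht : Tendsto t atTop (𝓝 0)) :
    Tendsto (fun n => secondMoment (μ.smooth (t n))) atTop (𝓝 (secondMoment μ)) := by
  refine P2.tendsto_integral_smooth μ ht (by fun_prop) (integrable_two_mul_sq_norm_fst_add μ 1) ?_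
  have h_small : ∀ᶠ n in atTop, 2 * t n ^ 2 < 1 :=
    ((ht.pow 2).const_mul 2).eventually_lt_const (by norm_num)
  filter_upwards [h_small] with n hn
  filter_upwards [ae_sq_norm_add_smul_le μ (t n)] with p hp
  rw [abs_of_nonneg (by positivity)]
  linarith

theorem smooth_le_smul_volume (μ : P2 d) {t : ℝ} (ht : 0 < t) : (μ.smooth t).toMeasure ≤
    ENNReal.ofReal ((volume (Metric.ball (0 : Eucl d) 1))⁻¹.toReal * (t ^ d)⁻¹) • volume := by
  refine Measure.le_iff.2 fun s hs => ?_
  change ((μ.toMeasure.prod (unif d)).map fun p => p.1 + t • p.2) s ≤ _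
  rw [Measure.map_apply (measurable_add_smul t) hs,
    Measure.prod_apply (measurable_add_smul t hs), Measure.smul_apply, smul_eq_mul]
  have h_fiber (x : Eucl d) : unif d ((fun u => t • u) ⁻¹' ((fun y => x + y) ⁻¹' s)) ≤
      ENNReal.ofReal ((volume (Metric.ball (0 : Eucl d) 1))⁻¹.toReal * (t ^ d)⁻¹) * volume s := by
    refine (unif_le_smul_volume _).trans_eq ?_
    rw [Measure.smul_apply, Measure.addHaar_preimage_smul _ ht.ne', measure_preimage_add,
      finrank_euclideanSpace, Fintype.card_fin, smul_eq_mul, ← mul_assoc,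
      ENNReal.ofReal_mul ENNReal.toReal_nonneg,
      ENNReal.ofReal_toReal (ENNReal.inv_ne_top.2 volume_unitBall_ne_zero),
      abs_of_pos (by positivity)]
  exact (lintegral_mono h_fiber).trans_eq (by simp)

theorem exists_Ent_smooth_le (d : ℕ) : ∃ K : ℝ, ∀ (μ : P2 d) (t : ℝ), 0 < t →
    Ent (μ.smooth t) ≤ ((K - d * Real.log t : ℝ) : EReal) := by
  have h_pos : 0 < (volume (Metric.ball (0 : Eucl d) 1))⁻¹.toReal :=
    ENNReal.toReal_pos (ENNReal.inv_ne_zero.2 measure_ball_lt_top.ne)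
      (ENNReal.inv_ne_top.2 volume_unitBall_ne_zero)
  refine ⟨Real.log (volume (Metric.ball (0 : Eucl d) 1))⁻¹.toReal, fun μ t ht => ?_⟩
  convert Ent_le_log_of_le_smul (by positivity) (smooth_le_smul_volume μ ht) using 2
  rw [Real.log_mul h_pos.ne' (by positivity), Real.log_inv, Real.log_pow, sub_eq_add_neg]

theorem exists_recovery_sequence (μ : P2 d) {σ : ℕ → ℝ} (hσ : ∀ n, 0 ≤ σ n)
    (hσ0 : Tendsto σ atTop (𝓝 0)) :
    ∃ (u : ℕ → P2 d) (e : ℕ → ℝ), Tendsto u atTop (𝓝 μ) ∧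
      Tendsto (fun n => secondMoment (u n)) atTop (𝓝 (secondMoment μ)) ∧
      (∀ n, Ent (u n) ≤ e n) ∧ Tendsto (fun n => σ n * e n) atTop (𝓝 0) := by
  obtain ⟨K, hK⟩ := exists_Ent_smooth_le d
  let t (n : ℕ) : ℝ := σ n + 1 / ((n : ℝ) + 1)
  have ht : Tendsto t atTop (𝓝 0) := by
    simpa only [add_zero] using hσ0.add (tendsto_one_div_add_atTop_nhds_zero_nat (𝕜 := ℝ))
  have h_log : Tendsto (fun n => σ n * Real.log (t n)) atTop (𝓝 0) := by
    have h_bound : Tendsto (fun n => |t n * Real.log (t n)|) atTop (𝓝 0) := by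
      simpa using ((Real.continuous_mul_log.tendsto 0).comp ht).abs
    refine squeeze_zero_norm (fun n => ?_) h_bound
    rw [Real.norm_eq_abs, abs_mul, abs_mul]
    gcongr
    · exact hσ n
    · exact le_add_of_nonneg_right (by positivity)
  refine ⟨fun n => μ.smooth (t n), fun n => K - d * Real.log (t n), μ.tendsto_smooth ht,
    μ.tendsto_secondMoment_smooth ht, fun n => hK μ _ (add_pos_of_nonneg_of_pos (hσ n) ?_), ?_⟩
  · positivity
  · convert (hσ0.mul_const K).sub (h_log.const_mul (d : ℝ)) using 2
    · ring
    · simp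

theorem exists_Ent_eq_coe (d : ℕ) : ∃ (μ : P2 d) (e : ℝ), Ent μ = e := by
  obtain ⟨K, hK⟩ := exists_Ent_smooth_le d
  let μ₀ : P2 d := ⟨⟨Measure.dirac 0, inferInstance⟩, integrable_dirac (by simp)⟩
  refine ⟨μ₀.smooth 1, (Ent (μ₀.smooth 1)).toReal, (EReal.coe_toReal ?_ (Ent_ne_bot _)).symm⟩
  exact ((hK μ₀ 1 one_pos).trans_lt (EReal.coe_lt_top _)).ne

end Smoothing

theorem GammaConverges.le_of_forall_le {X : Type*} [TopologicalSpace X] {F : ℕ → X → EReal}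
    {G : X → EReal} (h : GammaConverges F G) {m : ℕ → X} (hm : ∀ n y, F n (m n) ≤ F n y) {x : X}
    (hx : Tendsto m atTop (𝓝 x)) (y : X) : G x ≤ G y := by
  obtain ⟨u, -, hu⟩ := h.exists_recovery y
  calc G x ≤ liminf (fun n => F n (m n)) atTop := h.le_liminf x m hx
    _ ≤ limsup (fun n => F n (m n)) atTop := liminf_le_limsup
    _ ≤ limsup (fun n => F n (u n)) atTop := limsup_le_limsup (.of_forall fun n => hm n _)
    _ ≤ G y := hu

/-- Continuous convergence of `T n` to `T₀`: the values of `T n` along every convergent sequence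
of points converge to the value of `T₀` at the limit point. -/
def ContinuouslyConverges {X : Type*} [TopologicalSpace X] (T : ℕ → X → ℝ) (T₀ : X → ℝ) : Prop :=
  ∀ ⦃x : X⦄ ⦃u : ℕ → X⦄, Tendsto u atTop (𝓝 x) → Tendsto (fun n => T n (u n)) atTop (𝓝 (T₀ x))

section Regularized

variable {d : ℕ} {ζ σ : ℝ}

/-- The functional `T(μ) + (ζ/2) 𝔼_μ[‖x‖²] + σ Ent(μ)`, of which both stages are instances. The
entropy term is absent for `σ = 0`, since `0 * ⊤ = 0` in `EReal`. -/
noncomputable def regularized (T : P2 d → ℝ) (ζ σ : ℝ) (μ : P2 d) : EReal :=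
  ((T μ + ζ / 2 * secondMoment μ : ℝ) : EReal) + (σ : EReal) * Ent μ

theorem regularized_zero (T : P2 d → ℝ) (ζ : ℝ) (μ : P2 d) :
    regularized T ζ 0 μ = ((T μ + ζ / 2 * secondMoment μ : ℝ) : EReal) := by
  rw [regularized, EReal.coe_zero, zero_mul, add_zero]

theorem regularized_le (T : P2 d → ℝ) (ζ : ℝ) (hσ : 0 ≤ σ) {μ : P2 d} {e : ℝ} (he : Ent μ ≤ e) :
    regularized T ζ σ μ ≤ ((T μ + ζ / 2 * secondMoment μ + σ * e : ℝ) : EReal) := by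
  rw [regularized, EReal.coe_add _ (σ * e), EReal.coe_mul]
  gcongr

theorem exists_le_regularized (d : ℕ) {a : ℝ} (ha : 0 < a) :
    ∃ K : ℝ, ∀ (T : P2 d → ℝ) (ζ σ : ℝ) (μ : P2 d), 0 ≤ σ →
      ((T μ + (ζ / 2 - a * σ) * secondMoment μ - σ * K : ℝ) : EReal) ≤ regularized T ζ σ μ := by
  obtain ⟨K, hK⟩ := exists_neg_mul_secondMoment_sub_le_Ent d ha
  refine ⟨K, fun T ζ σ μ hσ => ?_⟩
  calc ((T μ + (ζ / 2 - a * σ) * secondMoment μ - σ * K : ℝ) : EReal)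
      = ((T μ + ζ / 2 * secondMoment μ : ℝ) : EReal) +
          (σ : EReal) * ((-(a * secondMoment μ) - K : ℝ) : EReal) := by
        rw [← EReal.coe_mul, ← EReal.coe_add]
        ring_nf
    _ ≤ regularized T ζ σ μ := by
        rw [regularized]
        gcongr
        exact hK μ

theorem exists_secondMoment_le_of_regularized_le (d : ℕ) (hζ : 0 < ζ) (S c : ℝ) :
    ∃ C : ℝ, ∀ (T : P2 d → ℝ) (σ : ℝ) (μ : P2 d), 0 ≤ T μ → 0 ≤ σ → σ ≤ S →
      regularized T ζ σ μ ≤ c → secondMoment μ ≤ C := by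
  obtain ⟨K, hK⟩ := exists_le_regularized d (a := ζ / (4 * (|S| + 1))) (by positivity)
  refine ⟨4 / ζ * (c + |S| * |K|), fun T σ μ hT hσ hσS h => ?_⟩
  have h_le := EReal.coe_le_coe_iff.1 ((hK T ζ σ μ hσ).trans h)
  have h_aσ : ζ / (4 * (|S| + 1)) * σ ≤ ζ / 4 := by
    have : σ ≤ |S| + 1 := by linarith [le_abs_self S]
    rw [div_mul_eq_mul_div, div_le_div_iff₀ (by positivity) (by positivity)]
    nlinarith
  have h_σK : σ * K ≤ |S| * |K| := by
    grw [le_abs_self K, hσS, le_abs_self S]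
  have h_moment : ζ / 4 * secondMoment μ ≤ c + |S| * |K| := by
    nlinarith [mul_le_mul_of_nonneg_right h_aσ (secondMoment_nonneg μ)]
  calc secondMoment μ = 4 / ζ * (ζ / 4 * secondMoment μ) := by field_simp
    _ ≤ 4 / ζ * (c + |S| * |K|) := by gcongr

theorem lowerSemicontinuous_regularized {T : P2 d → ℝ} (hT : Continuous T) (hζ : 0 < ζ)
    (hσ : 0 ≤ σ) : LowerSemicontinuous (regularized T ζ σ) := by
  rcases hσ.eq_or_lt with rfl | hσ
  · simp only [funext (regularized_zero T ζ)]
    refine continuous_coe_real_ereal.comp_lowerSemicontinuous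
      (hT.lowerSemicontinuous.add ?_) EReal.coe_strictMono.monotone
    exact (continuous_const_mul (ζ / 2)).comp_lowerSemicontinuous lowerSemicontinuous_secondMoment
      fun _ _ h => mul_le_mul_of_nonneg_left h (by positivity)
  · have h_mul : Continuous fun x : EReal => (σ : EReal) * x :=
      continuous_iff_continuousAt.2 fun _ => EReal.Tendsto.const_mul tendsto_id
        (.inl (EReal.coe_ne_bot σ)) (.inl (EReal.coe_ne_top σ))
    have h_scaled : LowerSemicontinuous fun μ : P2 d =>
        (σ : EReal) * (((ζ / (2 * σ) * secondMoment μ : ℝ) : EReal) + Ent μ) :=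
      h_mul.comp_lowerSemicontinuous
        (lowerSemicontinuous_mul_secondMoment_add_Ent (by positivity))
        fun _ _ h => mul_le_mul_of_nonneg_left h (EReal.coe_nonneg.2 hσ.le)
    convert lowerSemicontinuous_coe_add hT.lowerSemicontinuous h_scaled using 2 with μ
    rw [regularized, EReal.left_distrib_of_nonneg_of_ne_top (EReal.coe_nonneg.2 hσ.le)
      (EReal.coe_ne_top σ), ← EReal.coe_mul, ← add_assoc, ← EReal.coe_add]
    field_simp

theorem exists_forall_regularized_le {T : P2 d → ℝ} (hT : Continuous T) (hT0 : ∀ μ, 0 ≤ T μ)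
    (hζ : 0 < ζ) (hσ : 0 ≤ σ) : ∃ μ, ∀ ν, regularized T ζ σ μ ≤ regularized T ζ σ ν := by
  obtain ⟨μ₀, e, he⟩ := exists_Ent_eq_coe d
  set c : ℝ := T μ₀ + ζ / 2 * secondMoment μ₀ + σ * e
  have hμ₀ : regularized T ζ σ μ₀ ≤ c := regularized_le T ζ hσ he.le
  obtain ⟨C, hC⟩ := exists_secondMoment_le_of_regularized_le d hζ σ c
  obtain ⟨μ, -, hμ⟩ := ((lowerSemicontinuous_regularized hT hζ hσ).lowerSemicontinuousOn _)
    |>.exists_isMinOn ⟨μ₀, hC T σ μ₀ (hT0 _) hσ le_rfl hμ₀⟩ (isCompact_secondMoment_le C)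
  refine ⟨μ, fun ν => ?_⟩
  rcases le_total (regularized T ζ σ ν) c with hν | hν
  · exact hμ (hC T σ ν (hT0 _) hσ le_rfl hν)
  · exact (hμ (hC T σ μ₀ (hT0 _) hσ le_rfl hμ₀)).trans (hμ₀.trans hν)

theorem exists_regularized_eq_coe_of_forall_le {T : P2 d → ℝ} (hσ : 0 ≤ σ) {μ : P2 d}
    (hμ : ∀ ν, regularized T ζ σ μ ≤ regularized T ζ σ ν) :
    ∃ c : ℝ, regularized T ζ σ μ = c := by
  obtain ⟨ν, e, he⟩ := exists_Ent_eq_coe d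
  obtain ⟨K, hK⟩ := exists_le_regularized d one_pos
  have h_top : regularized T ζ σ μ ≠ ⊤ :=
    (((hμ ν).trans (regularized_le T ζ hσ he.le)).trans_lt (EReal.coe_lt_top _)).ne
  have h_bot : regularized T ζ σ μ ≠ ⊥ :=
    ne_bot_of_le_ne_bot (EReal.coe_ne_bot _) (hK T ζ σ μ hσ)
  exact ⟨_, (EReal.coe_toReal h_top h_bot).symm⟩

theorem regularized_mid_add_le {T : P2 d → ℝ} (hσ : 0 ≤ σ) {μ ν : P2 d} {δ c : ℝ}
    (hT : T (P2.mid μ ν) + δ ≤ (T μ + T ν) / 2) (hμ : regularized T ζ σ μ ≤ c)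
    (hν : regularized T ζ σ ν ≤ c) : regularized T ζ σ (P2.mid μ ν) + δ ≤ c := by
  rcases hσ.eq_or_lt with rfl | hσ
  · simp only [regularized_zero, EReal.coe_le_coe_iff, ← EReal.coe_add, secondMoment_mid] at *
    linarith
  have h_ent {κ : P2 d} (hκ : regularized T ζ σ κ ≤ c) : ∃ e : ℝ, Ent κ = e := by
    refine ⟨(Ent κ).toReal, (EReal.coe_toReal (fun h_top => ?_) (Ent_ne_bot κ)).symm⟩
    rw [regularized, h_top, EReal.coe_mul_top_of_pos hσ, EReal.coe_add_top, top_le_iff] at hκ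
    exact EReal.coe_ne_top c hκ
  obtain ⟨e, he⟩ := h_ent hμ
  obtain ⟨e', he'⟩ := h_ent hν
  grw [regularized_le T ζ hσ.le (Ent_mid_le he he')]
  rw [regularized, he, ← EReal.coe_mul, ← EReal.coe_add, EReal.coe_le_coe_iff] at hμ
  rw [regularized, he', ← EReal.coe_mul, ← EReal.coe_add, EReal.coe_le_coe_iff] at hν
  rw [← EReal.coe_add, EReal.coe_le_coe_iff, secondMoment_mid]
  linarith

end Regularized

section RegularizedLimit

variable {d : ℕ} {ζ : ℝ} {T : ℕ → P2 d → ℝ} {T₀ : P2 d → ℝ} {σ : ℕ → ℝ}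

theorem regularized_zero_le_liminf (hζ : 0 < ζ) (hσ : ∀ n, 0 ≤ σ n)
    (hσ0 : Tendsto σ atTop (𝓝 0)) {μ : P2 d} {u : ℕ → P2 d} (hu : Tendsto u atTop (𝓝 μ))
    (hT : Tendsto (fun n => T n (u n)) atTop (𝓝 (T₀ μ))) :
    regularized T₀ ζ 0 μ ≤ liminf (fun n => regularized (T n) ζ (σ n) (u n)) atTop := by
  obtain ⟨K, hK⟩ := exists_le_regularized d one_pos
  rw [regularized_zero]
  refine EReal.ge_of_forall_gt_iff_ge.1 fun c hc => le_liminf_of_le (by isBoundedDefault) ?_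
  replace hc : c < T₀ μ + ζ / 2 * secondMoment μ := EReal.coe_lt_coe_iff.1 hc
  obtain ⟨m, hm, hmμ⟩ : ∃ m, c < T₀ μ + ζ / 2 * m ∧ m < secondMoment μ := by
    have h_lt : (c - T₀ μ) / (ζ / 2) < secondMoment μ := by
      rw [div_lt_iff₀' (by positivity)]
      linarith
    obtain ⟨m, hm, hmμ⟩ := exists_between h_lt
    rw [div_lt_iff₀' (by positivity)] at hm
    exact ⟨m, by linarith, hmμ⟩
  have h_lim : Tendsto (fun n => T n (u n) + (ζ / 2 - 1 * σ n) * m - σ n * K) atTop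
      (𝓝 (T₀ μ + ζ / 2 * m)) := by
    simpa using (hT.add ((hσ0.const_mul 1).const_sub (ζ / 2) |>.mul_const m)).sub
      (hσ0.mul_const K)
  filter_upwards [h_lim.eventually_const_lt hm, hσ0.eventually_le_const (half_pos hζ),
    hu.eventually (lowerSemicontinuous_secondMoment μ m hmμ)] with n hn hσn hmn
  refine (EReal.coe_le_coe_iff.2 (hn.le.trans ?_)).trans (hK (T n) ζ (σ n) (u n) (hσ n))
  gcongr
  linarith

theorem exists_limsup_regularized_le (hT : ContinuouslyConverges T T₀) (ζ : ℝ) (hσ : ∀ n, 0 ≤ σ n)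
    (hσ0 : Tendsto σ atTop (𝓝 0)) (μ : P2 d) : ∃ u : ℕ → P2 d, Tendsto u atTop (𝓝 μ) ∧
      limsup (fun n => regularized (T n) ζ (σ n) (u n)) atTop ≤ regularized T₀ ζ 0 μ := by
  obtain ⟨u, e, hu, h_moment, he, hσe⟩ := exists_recovery_sequence μ hσ hσ0
  have h_lim : Tendsto (fun n => T n (u n) + ζ / 2 * secondMoment (u n) + σ n * e n) atTop
      (𝓝 (T₀ μ + ζ / 2 * secondMoment μ)) := by
    simpa only [add_zero] using ((hT hu).add (h_moment.const_mul (ζ / 2))).add hσe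
  refine ⟨u, hu, ?_⟩
  rw [regularized_zero, ← (EReal.tendsto_coe.2 h_lim).limsup_eq]
  exact limsup_le_limsup (.of_forall fun n => regularized_le (T n) ζ (hσ n) (he n))

theorem gammaConverges_regularized (hT : ContinuouslyConverges T T₀) (hζ : 0 < ζ)
    (hσ : ∀ n, 0 ≤ σ n) (hσ0 : Tendsto σ atTop (𝓝 0)) :
    GammaConverges (fun n => regularized (T n) ζ (σ n)) (regularized T₀ ζ 0) where
  le_liminf _ _ hu := regularized_zero_le_liminf hζ hσ hσ0 hu (hT hu)
  exists_recovery := exists_limsup_regularized_le hT ζ hσ hσ0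

theorem exists_secondMoment_le_of_forall_regularized_le (hT : ContinuouslyConverges T T₀)
    (hT0 : ∀ n μ, 0 ≤ T n μ) (hζ : 0 < ζ) (hσ : ∀ n, 0 ≤ σ n) (hσ0 : Tendsto σ atTop (𝓝 0))
    {m : ℕ → P2 d} (hm : ∀ n ν, regularized (T n) ζ (σ n) (m n) ≤ regularized (T n) ζ (σ n) ν) :
    ∃ C, ∀ n, secondMoment (m n) ≤ C := by
  obtain ⟨μ₀, e, he⟩ := exists_Ent_eq_coe d
  have h_lim : Tendsto (fun n => T n μ₀ + ζ / 2 * secondMoment μ₀ + σ n * e) atTop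
      (𝓝 (T₀ μ₀ + ζ / 2 * secondMoment μ₀ + 0 * e)) :=
    ((hT tendsto_const_nhds).add_const _).add (hσ0.mul_const e)
  obtain ⟨c, hc⟩ := h_lim.bddAbove_range
  obtain ⟨S, hS⟩ := hσ0.bddAbove_range
  obtain ⟨C, hC⟩ := exists_secondMoment_le_of_regularized_le d hζ S c
  refine ⟨C, fun n => hC (T n) (σ n) (m n) (hT0 n _) (hσ n) (hS (mem_range_self n)) ?_⟩
  calc regularized (T n) ζ (σ n) (m n) ≤ regularized (T n) ζ (σ n) μ₀ := hm n μ₀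
    _ ≤ _ := regularized_le (T n) ζ (hσ n) he.le
    _ ≤ c := EReal.coe_le_coe_iff.2 (hc (mem_range_self n))

theorem exists_forall_regularized_zero_le_of_tendsto (hT : ContinuouslyConverges T T₀)
    (hT0 : ∀ n μ, 0 ≤ T n μ) (hζ : 0 < ζ) (hσ : ∀ n, 0 ≤ σ n) (hσ0 : Tendsto σ atTop (𝓝 0))
    {m : ℕ → P2 d} (hm : ∀ n ν, regularized (T n) ζ (σ n) (m n) ≤ regularized (T n) ζ (σ n) ν)
    {μ : ProbabilityMeasure (Eucl d)} (hμ : Tendsto (fun n => (m n).1) atTop (𝓝 μ)) :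
    ∃ μlim : P2 d, μlim.1 = μ ∧ ∀ ν, regularized T₀ ζ 0 μlim ≤ regularized T₀ ζ 0 ν := by
  obtain ⟨C, hC⟩ := exists_secondMoment_le_of_forall_regularized_le hT hT0 hζ hσ hσ0 hm
  obtain ⟨μlim, rfl⟩ := exists_val_eq_of_tendsto hC hμ
  exact ⟨μlim, rfl, (gammaConverges_regularized hT hζ hσ hσ0).le_of_forall_le hm
    (tendsto_subtype_rng.2 hμ)⟩

end RegularizedLimit

section Network

/-- A Carathéodory function (measurable in the input `u`, continuous in the parameter `θ`) that is
bounded by `R`; a network is read as such a function. -/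
structure BoundedCaratheodory {U : Type*} [MeasurableSpace U] {d : ℕ} (Ψ : U → Eucl d → ℝ)
    (R : ℝ) : Prop where
  measurable_input : ∀ θ, Measurable fun u => Ψ u θ
  continuous : ∀ u, Continuous (Ψ u)
  abs_le : ∀ u θ, |Ψ u θ| ≤ R

variable {U : Type*} [MeasurableSpace U] {d : ℕ} {Ψ : U → Eucl d → ℝ} {R : ℝ}

theorem BoundedSmooth.boundedCaratheodory (h : BoundedSmooth Ψ R) : BoundedCaratheodory Ψ R where
  measurable_input := h.measurable_input
  continuous u := (h.differentiable u).continuous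
  abs_le := h.abs_le

namespace BoundedCaratheodory

theorem measurable_net (h : BoundedCaratheodory Ψ R) (μ : P2 d) : Measurable (net Ψ μ) := by
  have h_uncurry : Measurable (Function.uncurry fun (θ : Eucl d) (u : U) => Ψ u θ) :=
    measurable_uncurry_of_continuous_of_measurable h.continuous h.measurable_input
  exact (h_uncurry.stronglyMeasurable.integral_prod_left (μ := μ.toMeasure)).measurable

theorem abs_net_le (h : BoundedCaratheodory Ψ R) (μ : P2 d) (u : U) : |net Ψ μ u| ≤ R := by
  simpa [net] using norm_integral_le_of_norm_le_const (μ := μ.toMeasure) (f := Ψ u) (C := R)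
    (.of_forall (h.abs_le u))

theorem net_mid (h : BoundedCaratheodory Ψ R) (μ ν : P2 d) (u : U) :
    net Ψ (P2.mid μ ν) u = (net Ψ μ u + net Ψ ν u) / 2 :=
  have h_int (κ : P2 d) : Integrable (Ψ u) κ.toMeasure :=
    integrable_of_abs_le (h.continuous u).measurable (h.abs_le u)
  P2.integral_mid μ ν (h_int μ) (h_int ν)

theorem tendsto_net (h : BoundedCaratheodory Ψ R) {ι : Type*} {l : Filter ι} {v : ι → P2 d}
    {μ : P2 d} (hv : Tendsto v l (𝓝 μ)) (u : U) :
    Tendsto (fun i => net Ψ (v i) u) l (𝓝 (net Ψ μ u)) :=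
  P2.tendsto_integral hv (h.continuous u) (h.abs_le u)

theorem memLp_net_comp (h : BoundedCaratheodory Ψ R) (μ : P2 d) {Ω : Type*} [MeasurableSpace Ω]
    {P : Measure Ω} [IsFiniteMeasure P] {g : Ω → U} (hg : Measurable g) (p : ℝ≥0∞) :
    MemLp (fun ω => net Ψ μ (g ω)) p P :=
  .of_bound ((h.measurable_net μ).comp hg).aestronglyMeasurable R
    (.of_forall fun ω => h.abs_net_le μ (g ω))

end BoundedCaratheodory

end Network

theorem tendsto_integral_sq_of_dominated {Ω ι : Type*} [MeasurableSpace Ω] {P : Measure Ω}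
    {l : Filter ι} [l.IsCountablyGenerated] {F : ι → Ω → ℝ} {f g : Ω → ℝ}
    (hF : ∀ i, AEStronglyMeasurable (F i) P) (hg : MemLp g 2 P) (h_le : ∀ i ω, |F i ω| ≤ g ω)
    (h_lim : ∀ ω, Tendsto (fun i => F i ω) l (𝓝 (f ω))) :
    Tendsto (fun i => ∫ ω, F i ω ^ 2 ∂P) l (𝓝 (∫ ω, f ω ^ 2 ∂P)) := by
  refine tendsto_integral_filter_of_dominated_convergence (fun ω => g ω ^ 2)
    (.of_forall fun i => (hF i).pow 2) (.of_forall fun i => .of_forall fun ω => ?_)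
    hg.integrable_sq (.of_forall fun ω => (h_lim ω).pow 2)
  rw [norm_pow, Real.norm_eq_abs]
  gcongr
  exact h_le i ω

section Stages

variable {A W : Type*} [MeasurableSpace A] [MeasurableSpace W] {dx dz : ℕ}
  {ρ : Measure (A × ℝ × W)} {ΨA : A → Eucl dx → ℝ} {ΨW : W → Eucl dz → ℝ} {RA RW ζ : ℝ}

theorem U₁_nonneg (μx : P2 dx) (μz : P2 dz) : 0 ≤ U₁ ρ ΨA ΨW μx μz :=
  mul_nonneg (by norm_num) (integral_nonneg fun _ => sq_nonneg _)

theorem U₂_nonneg (μz : P2 dz) : 0 ≤ U₂ ρ ΨW μz :=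
  mul_nonneg (by norm_num) (integral_nonneg fun _ => sq_nonneg _)

variable [IsFiniteMeasure ρ]

theorem BoundedCaratheodory.memLp_net_fst (hA : BoundedCaratheodory ΨA RA) (μx : P2 dx) :
    MemLp (fun t : A × ℝ × W => net ΨA μx t.1) 2 ρ :=
  hA.memLp_net_comp μx measurable_fst 2

theorem BoundedCaratheodory.memLp_net_snd_snd (hW : BoundedCaratheodory ΨW RW) (μz : P2 dz) :
    MemLp (fun t : A × ℝ × W => net ΨW μz t.2.2) 2 ρ :=
  hW.memLp_net_comp μz measurable_snd.snd 2

theorem tendsto_U₁ (hA : BoundedCaratheodory ΨA RA) (hW : BoundedCaratheodory ΨW RW)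
    {ι : Type*} {l : Filter ι} [l.IsCountablyGenerated] {u : ι → P2 dx} {v : ι → P2 dz}
    {μx : P2 dx} {μz : P2 dz} (hu : Tendsto u l (𝓝 μx)) (hv : Tendsto v l (𝓝 μz)) :
    Tendsto (fun i => U₁ ρ ΨA ΨW (u i) (v i)) l (𝓝 (U₁ ρ ΨA ΨW μx μz)) :=
  .const_mul _ <| tendsto_integral_sq_of_dominated
    (fun i => ((hW.memLp_net_snd_snd (v i)).sub (hA.memLp_net_fst (u i))).aestronglyMeasurable)
    (memLp_const (RW + RA))
    (fun i _ => (abs_sub _ _).trans (add_le_add (hW.abs_net_le (v i) _) (hA.abs_net_le (u i) _)))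
    fun t => (hW.tendsto_net hv t.2.2).sub (hA.tendsto_net hu t.1)

theorem continuous_U₁ (hA : BoundedCaratheodory ΨA RA) (hW : BoundedCaratheodory ΨW RW)
    (μx : P2 dx) : Continuous (U₁ ρ ΨA ΨW μx) :=
  continuous_iff_continuousAt.2 fun _ => tendsto_U₁ hA hW tendsto_const_nhds tendsto_id

theorem continuous_U₂ (hy : MemLp (fun t : A × ℝ × W => t.2.1) 2 ρ)
    (hW : BoundedCaratheodory ΨW RW) : Continuous (U₂ ρ ΨW) :=
  continuous_iff_continuousAt.2 fun _ => Tendsto.const_mul _ <| tendsto_integral_sq_of_dominated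
    (fun ν => ((hW.memLp_net_snd_snd ν).sub hy).aestronglyMeasurable)
    ((memLp_const RW).add hy.abs)
    (fun ν _ => (abs_sub _ _).trans (add_le_add_left (hW.abs_net_le ν _) _))
    fun t => (hW.tendsto_net tendsto_id t.2.2).sub_const t.2.1

theorem U₁_mid_add (hA : BoundedCaratheodory ΨA RA) (hW : BoundedCaratheodory ΨW RW) (μx : P2 dx)
    (μz μz' : P2 dz) :
    U₁ ρ ΨA ΨW μx (P2.mid μz μz') + 1 / 8 * ∫ t, (net ΨW μz t.2.2 - net ΨW μz' t.2.2) ^ 2 ∂ρ =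
      (U₁ ρ ΨA ΨW μx μz + U₁ ρ ΨA ΨW μx μz') / 2 := by
  have h_res (ν : P2 dz) : Integrable (fun t => (net ΨW ν t.2.2 - net ΨA μx t.1) ^ 2) ρ :=
    ((hW.memLp_net_snd_snd ν).sub (hA.memLp_net_fst μx)).integrable_sq
  have h_diff : Integrable (fun t => (net ΨW μz t.2.2 - net ΨW μz' t.2.2) ^ 2) ρ :=
    ((hW.memLp_net_snd_snd μz).sub (hW.memLp_net_snd_snd μz')).integrable_sq
  have h_parallelogram (t : A × ℝ × W) : (net ΨW (P2.mid μz μz') t.2.2 - net ΨA μx t.1) ^ 2 =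
      1 / 2 * (net ΨW μz t.2.2 - net ΨA μx t.1) ^ 2 +
        1 / 2 * (net ΨW μz' t.2.2 - net ΨA μx t.1) ^ 2 -
        1 / 4 * (net ΨW μz t.2.2 - net ΨW μz' t.2.2) ^ 2 := by
    rw [hW.net_mid]
    ring
  simp only [U₁, h_parallelogram]
  rw [integral_sub (by exact ((h_res μz).const_mul _).add ((h_res μz').const_mul _))
    (h_diff.const_mul _), integral_add ((h_res μz).const_mul _) ((h_res μz').const_mul _),
    integral_const_mul, integral_const_mul, integral_const_mul]
  ring

theorem exists_isStageISolution (hA : BoundedCaratheodory ΨA RA) (hW : BoundedCaratheodory ΨW RW)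
    (hζ : 0 < ζ) {σ : ℝ} (hσ : 0 ≤ σ) (μx : P2 dx) :
    ∃ μz, IsStageISolution ρ ΨA ΨW ζ σ μx μz :=
  exists_forall_regularized_le (continuous_U₁ hA hW μx) (U₁_nonneg μx) hζ hσ

theorem IsStageISolution.net_ae_eq (hA : BoundedCaratheodory ΨA RA)
    (hW : BoundedCaratheodory ΨW RW) {σ : ℝ} (hσ : 0 ≤ σ) {μx : P2 dx} {μz μz' : P2 dz}
    (h : IsStageISolution ρ ΨA ΨW ζ σ μx μz) (h' : IsStageISolution ρ ΨA ΨW ζ σ μx μz') :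
    (fun t => net ΨW μz t.2.2) =ᵐ[ρ] fun t => net ΨW μz' t.2.2 := by
  obtain ⟨c, hc⟩ : ∃ c : ℝ, stageI ρ ΨA ΨW ζ σ μx μz = c :=
    exists_regularized_eq_coe_of_forall_le hσ h
  have h_mid := regularized_mid_add_le hσ (U₁_mid_add hA hW μx μz μz').le hc.le
    ((h' μz).trans hc.le)
  have h_sq_le : ∫ t, (net ΨW μz t.2.2 - net ΨW μz' t.2.2) ^ 2 ∂ρ ≤ 0 := by
    have h_le := (add_le_add_left (hc.ge.trans (h (P2.mid μz μz'))) _).trans h_mid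
    rw [← EReal.coe_add, EReal.coe_le_coe_iff] at h_le
    linarith
  have h_sq_zero := (integral_eq_zero_iff_of_nonneg (fun _ => sq_nonneg _)
    ((hW.memLp_net_snd_snd μz).sub (hW.memLp_net_snd_snd μz')).integrable_sq).1
    (h_sq_le.antisymm (integral_nonneg fun _ => sq_nonneg _))
  filter_upwards [h_sq_zero] with t ht
  exact sub_eq_zero.1 (pow_eq_zero_iff two_ne_zero |>.1 ht)

theorem IsStageISolution.U₂_eq (hA : BoundedCaratheodory ΨA RA) (hW : BoundedCaratheodory ΨW RW)
    {σ : ℝ} (hσ : 0 ≤ σ) {μx : P2 dx} {μz μz' : P2 dz} (h : IsStageISolution ρ ΨA ΨW ζ σ μx μz)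
    (h' : IsStageISolution ρ ΨA ΨW ζ σ μx μz') : U₂ ρ ΨW μz = U₂ ρ ΨW μz' := by
  rw [U₂, U₂]
  congr 1
  refine integral_congr_ae ?_
  filter_upwards [h.net_ae_eq hA hW hσ h'] with t ht
  rw [ht]

theorem exists_subseq_tendsto_isStageISolution (hA : BoundedCaratheodory ΨA RA)
    (hW : BoundedCaratheodory ΨW RW) (hζ : 0 < ζ) {σ : ℕ → ℝ} (hσ : ∀ n, 0 ≤ σ n)
    (hσ0 : Tendsto σ atTop (𝓝 0)) {u : ℕ → P2 dx} {μx : P2 dx} (hu : Tendsto u atTop (𝓝 μx))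
    {v : ℕ → P2 dz} (hv : ∀ n, IsStageISolution ρ ΨA ΨW ζ (σ n) (u n) (v n)) :
    ∃ (φ : ℕ → ℕ) (μz : P2 dz), Tendsto (v ∘ φ) atTop (𝓝 μz) ∧
      IsStageISolution ρ ΨA ΨW ζ 0 μx μz := by
  have hT {w : ℕ → P2 dx} (hw : Tendsto w atTop (𝓝 μx)) :
      ContinuouslyConverges (fun n => U₁ ρ ΨA ΨW (w n)) (U₁ ρ ΨA ΨW μx) :=
    fun _ _ h => tendsto_U₁ hA hW hw h
  obtain ⟨C, hC⟩ := exists_secondMoment_le_of_forall_regularized_le (hT hu)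
    (fun n => U₁_nonneg (u n)) hζ hσ hσ0 hv
  obtain ⟨μz, -, φ, hφ, hvφ⟩ := (isCompact_secondMoment_le C).tendsto_subseq hC
  have h_gamma := gammaConverges_regularized (hT (hu.comp hφ.tendsto_atTop)) hζ
    (fun n => hσ (φ n)) (hσ0.comp hφ.tendsto_atTop)
  exact ⟨φ, μz, hvφ, h_gamma.le_of_forall_le (fun n => hv (φ n)) hvφ⟩

theorem tendsto_U₂_of_isStageISolution (hy : MemLp (fun t : A × ℝ × W => t.2.1) 2 ρ)
    (hA : BoundedCaratheodory ΨA RA) (hW : BoundedCaratheodory ΨW RW) (hζ : 0 < ζ) {σ : ℕ → ℝ}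
    (hσ : ∀ n, 0 ≤ σ n) (hσ0 : Tendsto σ atTop (𝓝 0)) {u : ℕ → P2 dx} {μx : P2 dx}
    (hu : Tendsto u atTop (𝓝 μx)) {v : ℕ → P2 dz}
    (hv : ∀ n, IsStageISolution ρ ΨA ΨW ζ (σ n) (u n) (v n)) {μz : P2 dz}
    (hμz : IsStageISolution ρ ΨA ΨW ζ 0 μx μz) :
    Tendsto (fun n => U₂ ρ ΨW (v n)) atTop (𝓝 (U₂ ρ ΨW μz)) := by
  refine tendsto_of_subseq_tendsto fun ns hns => ?_
  obtain ⟨φ, ν, hφ, hν⟩ := exists_subseq_tendsto_isStageISolution hA hW hζ (fun n => hσ (ns n))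
    (hσ0.comp hns) (hu.comp hns) fun n => hv (ns n)
  refine ⟨φ, ?_⟩
  rw [hμz.U₂_eq hA hW le_rfl hν]
  exact ((continuous_U₂ hy hW).tendsto ν).comp hφ

theorem continuouslyConverges_U₂ (hy : MemLp (fun t : A × ℝ × W => t.2.1) 2 ρ)
    (hA : BoundedCaratheodory ΨA RA) (hW : BoundedCaratheodory ΨW RW) (hζ : 0 < ζ)
    {zstar : ℝ → P2 dx → P2 dz}
    (hz : ∀ σ, 0 ≤ σ → ∀ μx, IsStageISolution ρ ΨA ΨW ζ σ μx (zstar σ μx)) {σ : ℕ → ℝ}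
    (hσ : ∀ n, 0 ≤ σ n) (hσ0 : Tendsto σ atTop (𝓝 0)) :
    ContinuouslyConverges (fun n μx => U₂ ρ ΨW (zstar (σ n) μx))
      fun μx => U₂ ρ ΨW (zstar 0 μx) :=
  fun μx _ hu => tendsto_U₂_of_isStageISolution hy hA hW hζ hσ hσ0 hu
    (fun n => hz (σ n) (hσ n) _) (hz 0 le_rfl μx)

end Stages

end DFIV

theorem mainTheorem5_general {A W : Type*} [MeasurableSpace A] [MeasurableSpace W] {dx dz : ℕ}
    (ρ : Measure (A × ℝ × W)) [IsFiniteMeasure ρ]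
    (ΨA : A → DFIV.Eucl dx → ℝ) (ΨW : W → DFIV.Eucl dz → ℝ)
    (RA RW ζ₁ ζ₂ : ℝ) (hζ₁ : 0 < ζ₁) (hζ₂ : 0 < ζ₂)
    (hy : MemLp (fun t : A × ℝ × W => t.2.1) 2 ρ)
    (hA : DFIV.BoundedCaratheodory ΨA RA) (hW : DFIV.BoundedCaratheodory ΨW RW) :
    (∀ σ₁ : ℝ, 0 ≤ σ₁ → ∀ μx : DFIV.P2 dx,
      (∃ μz : DFIV.P2 dz, DFIV.IsStageISolution ρ ΨA ΨW ζ₁ σ₁ μx μz) ∧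
      ∀ μz μz' : DFIV.P2 dz, DFIV.IsStageISolution ρ ΨA ΨW ζ₁ σ₁ μx μz →
        DFIV.IsStageISolution ρ ΨA ΨW ζ₁ σ₁ μx μz' → DFIV.U₂ ρ ΨW μz = DFIV.U₂ ρ ΨW μz') ∧
    ∀ zstar : ℝ → DFIV.P2 dx → DFIV.P2 dz,
      (∀ σ₁ : ℝ, 0 ≤ σ₁ → ∀ μx : DFIV.P2 dx,
        DFIV.IsStageISolution ρ ΨA ΨW ζ₁ σ₁ μx (zstar σ₁ μx)) →
      ∀ σ : ℕ → ℝ × ℝ, (∀ n, 0 ≤ (σ n).1 ∧ 0 ≤ (σ n).2) → Tendsto σ atTop (𝓝 (0, 0)) →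
        DFIV.GammaConverges (fun n => DFIV.nestedII ρ ΨW ζ₂ zstar (σ n))
          (DFIV.nestedII ρ ΨW ζ₂ zstar (0, 0)) ∧
        ∀ (m : ℕ → DFIV.P2 dx) (μ : ProbabilityMeasure (DFIV.Eucl dx)),
          (∀ n ν, DFIV.nestedII ρ ΨW ζ₂ zstar (σ n) (m n) ≤
            DFIV.nestedII ρ ΨW ζ₂ zstar (σ n) ν) →
          Tendsto (fun n => (m n).1) atTop (𝓝 μ) →
          ∃ μlim : DFIV.P2 dx, μlim.1 = μ ∧
            ∀ ν, DFIV.nestedII ρ ΨW ζ₂ zstar (0, 0) μlim ≤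
              DFIV.nestedII ρ ΨW ζ₂ zstar (0, 0) ν := by
  refine ⟨fun σ₁ hσ₁ μx => ⟨DFIV.exists_isStageISolution hA hW hζ₁ hσ₁ μx,
    fun _ _ h h' => h.U₂_eq hA hW hσ₁ h'⟩, fun zstar hz σ hσ hσ0 => ?_⟩
  have hσ₁ : Tendsto (fun n => (σ n).1) atTop (𝓝 0) := (Prod.tendsto_iff _ _).1 hσ0 |>.1
  have hσ₂ : Tendsto (fun n => (σ n).2) atTop (𝓝 0) := (Prod.tendsto_iff _ _).1 hσ0 |>.2
  have hU₂ : DFIV.ContinuouslyConverges (fun n μx => DFIV.U₂ ρ ΨW (zstar (σ n).1 μx))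
      (fun μx => DFIV.U₂ ρ ΨW (zstar 0 μx)) :=
    DFIV.continuouslyConverges_U₂ hy hA hW hζ₁ hz (fun n => (hσ n).1) hσ₁
  exact ⟨DFIV.gammaConverges_regularized hU₂ hζ₂ (fun n => (hσ n).2) hσ₂,
    fun _ _ hm hμ => DFIV.exists_forall_regularized_zero_le_of_tendsto hU₂
      (fun _ _ => DFIV.U₂_nonneg _) hζ₂ (fun n => (hσ n).2) hσ₂ hm hμ⟩

theorem mainTheorem5 {A W : Type*} [MeasurableSpace A] [MeasurableSpace W] {dx dz : ℕ}
    (ρ : Measure (A × ℝ × W)) [IsProbabilityMeasure ρ]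
    (ΨA : A → DFIV.Eucl dx → ℝ) (ΨW : W → DFIV.Eucl dz → ℝ)
    (M R ζ₁ ζ₂ : ℝ) (hζ₁ : 0 < ζ₁) (hζ₂ : 0 < ζ₂)
    (hM : ∀ᵐ t ∂ρ, |t.2.1| ≤ M)
    (hA : DFIV.BoundedSmooth ΨA R) (hW : DFIV.BoundedSmooth ΨW R) :
    -- Stage I is solvable for all `σ₁ ≥ 0`, and the Stage II error does not depend on the solution
    (∀ σ₁ : ℝ, 0 ≤ σ₁ → ∀ μx : DFIV.P2 dx,
      (∃ μz : DFIV.P2 dz, DFIV.IsStageISolution ρ ΨA ΨW ζ₁ σ₁ μx μz) ∧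
      ∀ μz μz' : DFIV.P2 dz, DFIV.IsStageISolution ρ ΨA ΨW ζ₁ σ₁ μx μz →
        DFIV.IsStageISolution ρ ΨA ΨW ζ₁ σ₁ μx μz' → DFIV.U₂ ρ ΨW μz = DFIV.U₂ ρ ΨW μz') ∧
    ∀ zstar : ℝ → DFIV.P2 dx → DFIV.P2 dz,
      (∀ σ₁ : ℝ, 0 ≤ σ₁ → ∀ μx : DFIV.P2 dx,
        DFIV.IsStageISolution ρ ΨA ΨW ζ₁ σ₁ μx (zstar σ₁ μx)) →
      ∀ σ : ℕ → ℝ × ℝ, (∀ n, 0 < (σ n).1 ∧ 0 < (σ n).2) → Tendsto σ atTop (𝓝 (0, 0)) →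
        -- Γ-convergence for the weak topology
        DFIV.GammaConverges (fun n => DFIV.nestedII ρ ΨW ζ₂ zstar (σ n))
          (DFIV.nestedII ρ ΨW ζ₂ zstar (0, 0)) ∧
        -- weak limits of global minimizers are global minimizers of the unregularized problem
        ∀ (m : ℕ → DFIV.P2 dx) (μ : ProbabilityMeasure (DFIV.Eucl dx)),
          (∀ n ν, DFIV.nestedII ρ ΨW ζ₂ zstar (σ n) (m n) ≤
            DFIV.nestedII ρ ΨW ζ₂ zstar (σ n) ν) →
          Tendsto (fun n => (m n).1) atTop (𝓝 μ) →
          ∃ μlim : DFIV.P2 dx, μlim.1 = μ ∧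
            ∀ ν, DFIV.nestedII ρ ΨW ζ₂ zstar (0, 0) μlim ≤
              DFIV.nestedII ρ ΨW ζ₂ zstar (0, 0) ν := by
  have hy : MemLp (fun t : A × ℝ × W => t.2.1) 2 ρ :=
    .of_bound measurable_snd.fst.aestronglyMeasurable M hM
  obtain ⟨h_stageI, h_stageII⟩ := mainTheorem5_general ρ ΨA ΨW R R ζ₁ ζ₂ hζ₁ hζ₂ hy
    hA.boundedCaratheodory hW.boundedCaratheodory
  exact ⟨h_stageI, fun zstar hz σ hσ => h_stageII zstar hz σ fun n => (hσ n).imp le_of_lt le_of_lt⟩
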